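/- Let $d\ge 3$, let $\mathbb B$ and $\mathbb S$ be the open unit ball and the unit sphere of $\mathbb R^d$, and let $C>1$, $c<1$, $M\in\mathbb R$ and $r<1$ be constants. There are constants $0<a,b<\infty$, depending only on $d,C,c,M,r$, with the following property. Let $\varphi,\nu$ be nonnegative Borel functions on $\mathbb B$ such that, for all $x\in\mathbb B$, $$\tfrac1C\varphi(x)\le\varphi(y)\le C\varphi(x)\quad\text{and}\quad \tfrac1C\nu(x)\le\nu(y)\le C\nu(x)\qquad\text{whenever } |y-x|<\tfrac{1-|x|}{2},$$ $$\frac{\varphi(x)}{1-|x|}\le c,\qquad (1-|x|)\,\varphi(x)^{d-2}\,\nu(x)\le \frac{M}{1-|x|}\ \text{ if } |x|\ge r .$$ Let $\mathcal P$ be a Poisson random point process on the Borel subsets of $\mathbb B$ with mean measure $\nu(x)\,dx$, and let $A_{\mathcal P}=\bigcup_{p\in\mathcal P}\overline B(p,\varphi(p))$ be the union of the closed balls with centres $p\in\mathcal P$ and radii $\varphi(p)$. Let $\{Q_k\}$ be a Whitney decomposition of $\mathbb B$, that is, a sequence of closed cubes with sides parallel to the axes, with disjoint interiors and union $\mathbb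 B$, such that $\operatorname{diam}(Q_k)\le\operatorname{dist}(Q_k,\mathbb S)\le 4\operatorname{diam}(Q_k)$. Let $\ell(Q_k)$ be the sidelength of $Q_k$, let $\rho_k(\tau)$ be the distance from $Q_k$ to $\tau$, let $\operatorname{cap}$ be Newtonian capacity (normalised so that a ball of radius $s$ has capacity $s^{d-2}$), and for $\tau\in\mathbb S$ let $$W(A_{\mathcal P},\tau)=\sum_k\frac{\ell(Q_k)^2}{\rho_k(\tau)^d}\,\operatorname{cap}(A_{\mathcal P}\cap Q_k).$$ Then, for every $\tau\in\mathbb S$, $W(A_{\mathcal P},\tau)$ is a random variable (measurable up to a null set) with values in $[0,\infty]$, and $$a\int_{\mathbb B}\frac{(1-|x|^2)^2}{|\tau-x|^d}\,\varphi(x)^{d-2}\nu(x)\,dx\ \le\ \mathbb E\big[W(A_{\mathcal P},\tau)\big]\ \le\ b\int_{\mathbb B}\frac{(1-|x|^2)^2}{|\tau-x|^d}\,\varphi(x)^{d-2}\nu(x)\,dx ,$$ where all three terms may be infinite. -/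

import Mathlib

open MeasureTheory ProbabilityTheory Set
open scoped ENNReal NNReal

noncomputable section

namespace PercolationDiffusion

/-- Euclidean space of dimension `d`. -/
abbrev E (d : ℕ) : Type := EuclideanSpace ℝ (Fin d)

/-- The open unit ball of `ℝ^d`. -/
def unitBall (d : ℕ) : Set (E d) := Metric.ball 0 1

/-- The unit sphere of `ℝ^d`. -/
def unitSphere (d : ℕ) : Set (E d) := Metric.sphere 0 1

/-! ### Newtonian capacity -/

/-- The Newtonian kernel `|x - y|^{2-d}`, with value `∞` on the diagonal (for `d ≥ 3`). -/
def newtonKernel {d : ℕ} (x y : E d) : ℝ≥0∞ := (edist x y ^ (d - 2))⁻¹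

/-- The Newtonian potential of a measure. -/
def newtonPotential {d : ℕ} (m : Measure (E d)) (x : E d) : ℝ≥0∞ := ∫⁻ y, newtonKernel x y ∂m

/-- The Newtonian capacity of a (Borel) set `A`: the largest total mass of a measure carried by a
compact subset of `A` whose potential is at most `1` everywhere. It is normalised so that a ball
of radius `r` has capacity `r^{d-2}`. -/
def newtonCap {d : ℕ} (A : Set (E d)) : ℝ≥0∞ :=
  ⨆ (m : Measure (E d)) (_ : ∃ K ⊆ A, IsCompact K ∧ m Kᶜ = 0)
    (_ : ∀ x, newtonPotential m x ≤ 1), m univ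

/-! ### Whitney cubes -/

/-- The closed cube with sides parallel to the axes, lowest corner `a` and sidelength `l`. -/
def cube {d : ℕ} (a : E d) (l : ℝ) : Set (E d) := {x | ∀ i, a i ≤ x i ∧ x i ≤ a i + l}

/-- The distance between two sets. -/
def setDist {d : ℕ} (A B : Set (E d)) : ℝ := sInf (image2 dist A B)

/-- A Whitney decomposition `Q_0, Q_1, …` of the unit ball: closed cubes with sides parallel to
the axes and with disjoint interiors, which fill the ball, and whose diameters are comparable to
their distances to the sphere. -/
structure WhitneyDecomposition (d : ℕ) where
  /-- the lowest corner of the `k`-th cube -/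
  corner : ℕ → E d
  /-- the sidelength of the `k`-th cube -/
  side : ℕ → ℝ
  side_pos : ∀ k, 0 < side k
  iUnion_eq : ⋃ k, cube (corner k) (side k) = unitBall d
  disjoint_interior : ∀ j k, j ≠ k →
    Disjoint (interior (cube (corner j) (side j))) (interior (cube (corner k) (side k)))
  diam_le : ∀ k, Metric.diam (cube (corner k) (side k)) ≤
    setDist (cube (corner k) (side k)) (unitSphere d)
  le_diam : ∀ k, setDist (cube (corner k) (side k)) (unitSphere d) ≤
    4 * Metric.diam (cube (corner k) (side k))

/-- The `k`-th cube of a Whitney decomposition. -/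
def WhitneyDecomposition.Q {d : ℕ} (D : WhitneyDecomposition d) (k : ℕ) : Set (E d) :=
  cube (D.corner k) (D.side k)

/-- Aikawa's series `W(A, τ) = ∑_k ℓ(Q_k)² ρ_k(τ)^{-d} cap(A ∩ Q_k)`, where `ρ_k(τ)` is the
distance from `Q_k` to `τ`. -/
def aikawaSeries {d : ℕ} (D : WhitneyDecomposition d) (A : Set (E d)) (τ : E d) : ℝ≥0∞ :=
  ∑' k, ENNReal.ofReal (D.side k ^ 2 / Metric.infDist τ (D.Q k) ^ d) * newtonCap (A ∩ D.Q k)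

/-! ### Poisson point processes and obstacles -/

/-- The number of points of the random configuration `𝓟` that lie in `A`. -/
def pointCount {Ω X : Type*} (𝓟 : Ω → Set X) (A : Set X) (ω : Ω) : ℕ∞ := (𝓟 ω ∩ A).encard

/-- `𝓟` is a Poisson random point process on the Borel subsets of `S`, with mean measure `μ`:
the number of points in a measurable subset `A` of `S` is a Poisson random variable with mean
`μ A` (infinite almost surely if `μ A = ∞`), and the numbers of points in disjoint measurable
sets are independent. -/
structure IsPoissonProcess {Ω X : Type*} [MeasurableSpace Ω] [MeasurableSpace X]
    (P : Measure Ω) (S : Set X) (μ : Measure X) (𝓟 : Ω → Set X) : Prop where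
  subset : ∀ ω, 𝓟 ω ⊆ S
  measurable : ∀ A ⊆ S, MeasurableSet A → Measurable (pointCount 𝓟 A)
  law : ∀ A ⊆ S, MeasurableSet A → μ A ≠ ∞ →
    P.map (pointCount 𝓟 A) = (poissonMeasure (μ A).toNNReal).map (fun n : ℕ ↦ (n : ℕ∞))
  law_top : ∀ A ⊆ S, MeasurableSet A → μ A = ∞ → ∀ᵐ ω ∂P, pointCount 𝓟 A ω = ⊤
  indep : ∀ (n : ℕ) (A : Fin n → Set X), (∀ i, A i ⊆ S) → (∀ i, MeasurableSet (A i)) →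
    (∀ i j, i ≠ j → Disjoint (A i) (A j)) → iIndepFun (fun i ↦ pointCount 𝓟 (A i)) P

/-- The archipelago: the union of the closed balls centred at the points `p` of a configuration,
with radii `φ p`. -/
def archipelago {d : ℕ} (φ : E d → ℝ) (𝓟 : Set (E d)) : Set (E d) :=
  ⋃ p ∈ 𝓟, Metric.closedBall p (φ p)

/-- The standing assumptions on the radius function `φ` and the intensity function `ν` on the unit
ball, with explicit constants: both are roughly constant at the scale of the distance to the
sphere (constant `C`), `φ(x) / (1 - |x|) ≤ c`, and
`(1 - |x|) φ(x)^{d-2} ν(x) = O(1 / (1 - |x|))` as `|x| → 1` (constant `M`, valid for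
`r ≤ |x| < 1`). -/
structure Admissible {d : ℕ} (C c M r : ℝ) (φ ν : E d → ℝ) : Prop where
  measurable_radius : Measurable φ
  measurable_intensity : Measurable ν
  radius_nonneg : ∀ x ∈ unitBall d, 0 ≤ φ x
  intensity_nonneg : ∀ x ∈ unitBall d, 0 ≤ ν x
  radius_comparable : ∀ x ∈ unitBall d, ∀ y ∈ Metric.ball x ((1 - ‖x‖) / 2),
    1 / C * φ x ≤ φ y ∧ φ y ≤ C * φ x
  intensity_comparable : ∀ x ∈ unitBall d, ∀ y ∈ Metric.ball x ((1 - ‖x‖) / 2),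
    1 / C * ν x ≤ ν y ∧ ν y ≤ C * ν x
  radius_le : ∀ x ∈ unitBall d, φ x / (1 - ‖x‖) ≤ c
  intensity_bound : ∀ x ∈ unitBall d, r ≤ ‖x‖ →
    (1 - ‖x‖) * φ x ^ (d - 2) * ν x ≤ M * (1 / (1 - ‖x‖))

/-- The measure `ν(x) dx`. -/
def intensityMeasure {d : ℕ} (ν : E d → ℝ) : Measure (E d) :=
  volume.withDensity (fun x ↦ ENNReal.ofReal (ν x))

/-- The Poisson balayage `∫_𝔹 (1 - |x|²)² |τ - x|^{-d} φ(x)^{d-2} ν(x) dx`, possibly infinite. -/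
def poissonBalayage {d : ℕ} (φ ν : E d → ℝ) (τ : E d) : ℝ≥0∞ :=
  ∫⁻ x in unitBall d,
    ENNReal.ofReal ((1 - ‖x‖ ^ 2) ^ 2 / ‖τ - x‖ ^ d * φ x ^ (d - 2) * ν x)

end PercolationDiffusion

end

open PercolationDiffusion

/-!
The expectation of `aikawaSeries` is the sum over the Whitney cubes `Q` of the weight of `Q` times
the expected capacity of the archipelago in `Q`, so everything reduces to showing that this expected
capacity is comparable to `∫ φ^{d-2} ν` over `Q`, or over a neighbourhood of `Q` for the upper
bound: on a Whitney cube the density `(1 - |x|²)² |τ - x|^{-d}` is comparable to `ℓ(Q)² ρ(τ)^{-d}`.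

*Upper bound.* Capacity is countably subadditive (`newtonCap_iUnion_le`) and a ball of radius `s`
has capacity at most `s^{d-2}` (`newtonCap_closedBall_le`), so Campbell's formula bounds the
expected capacity in `Q` by the integral of `φ^{d-2} ν` over the points whose balls meet `Q`
(`Admissible.lintegral_newtonCap_le`). As `φ(p) ≤ c (1 - |p|)` with `c < 1`, the ball around `p`
meets a bounded number of cubes, all of size comparable to `1 - |p|`
(`WhitneyDecomposition.tsum_weight_le`).

*Lower bound.* Let `l` be the side of `Q` and let `t` be comparable to the radii in `Q`. Divide `Q`
into cells of side `s` with `s^d` comparable to `t^{d-2} l²`, and keep one point of the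
configuration in each occupied cell. The sum of the uniform densities of total mass of order
`t^{d-2}` on small cubes around these points has a bounded potential, whatever the set of occupied
cells: near a given point there are boundedly many cells, and the contribution of the others is
compared with `l^{-2} ∫_Q |x - z|^{2-d} dz`. So the capacity is at least a constant times `t^{d-2}`
times the number of occupied cells (`card_mul_le_newtonCap`). The bound
`φ^{d-2} ν = O((1 - |x|)^{-2})` makes the mean measure of a cell bounded, and then a cell is occupied with a probability comparable
to its mean measure (`IsPoissonProcess.measure_le_mul_measure_pointCount_ne_zero`). Neither second
moments nor independence are involved. Chains of balls extend the bound on `φ^{d-2} ν` from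
`|x| ≥ r` to the whole ball (`Admissible.density_le`).

*Measurability.* Capacity is continuous along decreasing sequences of compact sets
(`iInf_newtonCap_le`), by weak compactness of measures and lower semicontinuity of potentials. So
the capacity of the archipelago in `Q` is almost surely the infimum of the capacities of approximations
that depend only on which sets of a finite family are occupied
(`IsPoissonProcess.aemeasurable_newtonCap`).
-/

noncomputable section

namespace PercolationDiffusion

open scoped Topology

/-! ### Newtonian capacity -/

theorem continuous_newtonKernel {d : ℕ} (x : E d) : Continuous (newtonKernel x) := by
  unfold newtonKernel
  exact continuous_inv.comp ((ENNReal.continuous_pow _).comp (continuous_const.edist continuous_id))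

theorem measurable_newtonKernel {d : ℕ} (x : E d) : Measurable (newtonKernel x) :=
  (continuous_newtonKernel x).measurable

theorem newtonCap_mono {d : ℕ} {A B : Set (E d)} (h : A ⊆ B) : newtonCap A ≤ newtonCap B := by
  unfold newtonCap
  refine iSup_le fun m ↦ iSup_le fun ⟨K, hK, hc, h0⟩ ↦ iSup_le fun hp ↦ ?_
  exact le_iSup_of_le m (le_iSup_of_le ⟨K, hK.trans h, hc, h0⟩ (le_iSup_of_le hp le_rfl))

theorem le_newtonCap {d : ℕ} {A K : Set (E d)} {m : Measure (E d)} (hKA : K ⊆ A)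
    (hK : IsCompact K) (h0 : m Kᶜ = 0) (hm : ∀ x, newtonPotential m x ≤ 1) :
    m univ ≤ newtonCap A :=
  le_iSup_of_le m (le_iSup_of_le ⟨K, hKA, hK, h0⟩ (le_iSup_of_le hm le_rfl))

theorem measure_univ_eq_of_measure_compl_eq_zero {α : Type*} [MeasurableSpace α] {m : Measure α}
    {K : Set α} (h0 : m Kᶜ = 0) : m univ = m K := by
  refine le_antisymm ?_ (measure_mono (subset_univ _))
  calc m univ ≤ m K + m Kᶜ := by rw [← union_compl_self K]; exact measure_union_le _ _
    _ = m K := by rw [h0, add_zero]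

/-- Testing the potential at the centre of the ball bounds the mass of every competitor. -/
theorem newtonCap_closedBall_le {d : ℕ} (p : E d) (s : ℝ) :
    newtonCap (Metric.closedBall p s) ≤ ENNReal.ofReal s ^ (d - 2) := by
  refine iSup_le fun m ↦ iSup_le fun ⟨K, hK, hc, h0⟩ ↦ iSup_le fun hp ↦ ?_
  have h1 : (ENNReal.ofReal s ^ (d - 2))⁻¹ * m K ≤ 1 := by
    refine le_trans ?_ (hp p)
    calc (ENNReal.ofReal s ^ (d - 2))⁻¹ * m K = ∫⁻ _ in K, (ENNReal.ofReal s ^ (d - 2))⁻¹ ∂m := by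
          rw [setLIntegral_const]
      _ ≤ ∫⁻ y in K, newtonKernel p y ∂m := by
          refine setLIntegral_mono' hc.measurableSet fun y hy ↦ ?_
          unfold newtonKernel
          have : dist y p ≤ s := hK hy
          rw [edist_comm, edist_dist]
          gcongr
      _ ≤ _ := setLIntegral_le_lintegral _ _
  rw [measure_univ_eq_of_measure_compl_eq_zero h0]
  rw [mul_comm, ← div_eq_mul_inv,
    ENNReal.div_le_iff_le_mul (Or.inr ENNReal.one_ne_top) (Or.inr one_ne_zero), one_mul] at h1
  exact h1

theorem newtonPotential_mono {d : ℕ} {m m' : Measure (E d)} (h : m ≤ m') (x : E d) :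
    newtonPotential m x ≤ newtonPotential m' x :=
  lintegral_mono' h le_rfl

/-- Countable subadditivity: restricting a competitor to one of the sets keeps its potential below
`1`, so that the restriction is a competitor for that set. -/
theorem newtonCap_iUnion_le {d : ℕ} {ι : Type*} [Countable ι] {B : ι → Set (E d)}
    (hB : ∀ i, IsClosed (B i)) : newtonCap (⋃ i, B i) ≤ ∑' i, newtonCap (B i) := by
  refine iSup_le fun m ↦ iSup_le fun ⟨K, hK, hc, h0⟩ ↦ iSup_le fun hp ↦ ?_
  rw [measure_univ_eq_of_measure_compl_eq_zero h0]
  have hsub : K ⊆ ⋃ i, K ∩ B i := by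
    rw [← inter_iUnion]; exact subset_inter le_rfl hK
  refine (measure_mono hsub).trans ((measure_iUnion_le _).trans (ENNReal.tsum_le_tsum fun i ↦ ?_))
  have hci : IsCompact (K ∩ B i) := hc.inter_right (hB i)
  have := le_newtonCap (m := m.restrict (K ∩ B i)) (inter_subset_right : K ∩ B i ⊆ B i) hci
    (by rw [Measure.restrict_apply hci.measurableSet.compl]; simp)
    (fun x ↦ (newtonPotential_mono Measure.restrict_le_self x).trans (hp x))
  simpa using this

theorem newtonCap_lt_top_of_isCompact {d : ℕ} {K : Set (E d)} (hK : IsCompact K) :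
    newtonCap K < ∞ := by
  obtain ⟨R, hR⟩ := hK.isBounded.subset_closedBall 0
  exact ((newtonCap_mono hR).trans (newtonCap_closedBall_le 0 R)).trans_lt
    (ENNReal.pow_lt_top ENNReal.ofReal_lt_top)

/-- The constraint `∫ k(x, y) dm(y) ≤ 1` passes to weak limits, because the kernel is the
supremum of its bounded continuous truncations. -/
theorem newtonPotential_le_one_of_tendsto {d : ℕ} {ι : Type*} {l : Filter ι} [l.NeBot]
    {μ : ι → FiniteMeasure (E d)} {m : FiniteMeasure (E d)} (h : Filter.Tendsto μ l (𝓝 m)) (x : E d)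
    (hμ : ∀ i, newtonPotential (μ i : Measure (E d)) x ≤ 1) :
    newtonPotential (m : Measure (E d)) x ≤ 1 := by
  have key : ∀ N : ℕ, ∫⁻ y, min (newtonKernel x y) N ∂(m : Measure (E d)) ≤ 1 := by
    intro N
    have hcont : Continuous fun y ↦ (min (newtonKernel x y) N).toNNReal := by
      refine ENNReal.continuousOn_toNNReal.comp_continuous
        ((continuous_newtonKernel x).min continuous_const) fun y ↦ ?_
      exact ((min_le_right _ _).trans_lt (ENNReal.natCast_lt_top N)).ne
    let f : BoundedContinuousFunction (E d) ℝ≥0 :=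
      BoundedContinuousFunction.mkOfBound ⟨_, hcont⟩ N (by
        intro y z
        have hb : ∀ y, (min (newtonKernel x y) N).toNNReal ≤ N := fun y ↦ by
          have := ENNReal.toNNReal_mono (ENNReal.natCast_ne_top N)
            (min_le_right (newtonKernel x y) N)
          simpa using this
        have h1 : ((min (newtonKernel x y) N).toNNReal : ℝ) ≤ N := by exact_mod_cast hb y
        have h2 : ((min (newtonKernel x z) N).toNNReal : ℝ) ≤ N := by exact_mod_cast hb z
        rw [NNReal.dist_eq, ContinuousMap.coe_mk, abs_le]
        constructor <;>
          linarith [(min (newtonKernel x y) N).toNNReal.2, (min (newtonKernel x z) N).toNNReal.2])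
    have hf : ∀ y, (f y : ℝ≥0∞) = min (newtonKernel x y) N := fun y ↦
      ENNReal.coe_toNNReal ((min_le_right _ _).trans_lt (ENNReal.natCast_lt_top N)).ne
    have ht := (FiniteMeasure.tendsto_iff_forall_lintegral_tendsto.1 h) f
    simp only [hf] at ht
    refine le_of_tendsto ht (Filter.Eventually.of_forall fun i ↦ le_trans ?_ (hμ i))
    exact lintegral_mono fun y ↦ min_le_left _ _
  have hsup : ∀ y, newtonKernel x y = ⨆ N : ℕ, min (newtonKernel x y) N := by
    intro y
    rw [← inf_iSup_eq, ENNReal.iSup_natCast]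
    simp
  unfold newtonPotential
  rw [lintegral_congr hsup, lintegral_iSup
    (fun N ↦ (measurable_newtonKernel x).min measurable_const)]
  · exact iSup_le key
  · intro N N' hN y
    exact min_le_min_left _ (by exact_mod_cast hN)

/-- Outer continuity of capacity on decreasing sequences of compact sets. Near-optimal measures
for the sets `K n` have a weak limit point by compactness, and it is a competitor for the
intersection. -/
theorem iInf_newtonCap_le {d : ℕ} {K : ℕ → Set (E d)} (hK : ∀ n, IsCompact (K n))
    (hanti : Antitone K) : ⨅ n, newtonCap (K n) ≤ newtonCap (⋂ n, K n) := by
  refine le_of_forall_lt fun a ha ↦ ?_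
  obtain ⟨b, hab, hb⟩ := exists_between ha
  refine hab.trans_le ?_
  have h1 : ∀ n, ∃ m : Measure (E d), m (K n)ᶜ = 0 ∧ (∀ x, newtonPotential m x ≤ 1) ∧
      b < m univ := by
    intro n
    have : b < newtonCap (K n) := hb.trans_le (iInf_le _ n)
    simp only [newtonCap, lt_iSup_iff] at this
    obtain ⟨m, ⟨K', hK', -, h0⟩, hp, hlt⟩ := this
    exact ⟨m, measure_mono_null (compl_subset_compl.2 hK') h0, hp, hlt⟩
  choose m hm0 hmp hmb using h1
  have hle : ∀ n, m n univ ≤ newtonCap (K 0) := fun n ↦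
    (le_newtonCap le_rfl (hK n) (hm0 n) (hmp n)).trans (newtonCap_mono (hanti (Nat.zero_le n)))
  have hfin := newtonCap_lt_top_of_isCompact (hK 0)
  have : ∀ n, IsFiniteMeasure (m n) := fun n ↦ ⟨(hle n).trans_lt hfin⟩
  let μ : ℕ → FiniteMeasure (E d) := fun n ↦ ⟨m n, this n⟩
  set c := (newtonCap (K 0)).toNNReal
  have hmass : ∀ n, (μ n).mass ≤ c := fun n ↦ ENNReal.toNNReal_mono hfin.ne (hle n)
  have hmem : ∀ j n, j ≤ n → μ n ∈ {ν : FiniteMeasure (E d) | ν.mass ≤ c ∧ ν (K j)ᶜ = 0} := by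
    intro j n hjn
    refine ⟨hmass n, ?_⟩
    have : m n (K j)ᶜ = 0 := measure_mono_null (compl_subset_compl.2 (hanti hjn)) (hm0 n)
    exact (FiniteMeasure.null_iff_toMeasure_null (μ n) _).2 this
  have hcomp := fun j ↦ isCompact_setOfPred_finiteMeasure_le_of_isCompact c (hK j)
  -- a limit along an ultrafilter avoids the extraction of a subsequence
  obtain ⟨ν, -, hν⟩ := (hcomp 0).ultrafilter_le_nhds ((Filter.hyperfilter ℕ).map μ) (by
    rw [Ultrafilter.coe_map]
    exact Filter.tendsto_principal.2 (Filter.Eventually.of_forall fun n ↦ hmem 0 n (Nat.zero_le n)))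
  have ht : Filter.Tendsto μ (Filter.hyperfilter ℕ : Filter ℕ) (𝓝 ν) := hν
  have hge : ∀ j, ∀ᶠ n in (Filter.hyperfilter ℕ : Filter ℕ), j ≤ n := fun j ↦
    (Nat.hyperfilter_le_atTop) (Filter.eventually_ge_atTop j)
  -- measures carried by `K j` form a compact, hence closed set, so the limit is carried by `K j`
  have hν0 : ∀ j, (ν : Measure (E d)) (K j)ᶜ = 0 := by
    intro j
    have := (hcomp j).isClosed.mem_of_tendsto ht ((hge j).mono fun n hn ↦ hmem j n hn)
    exact (FiniteMeasure.null_iff_toMeasure_null ν _).1 this.2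
  have hνb : b ≤ (ν : Measure (E d)) univ := by
    have h2 : Filter.Tendsto (fun n ↦ ((μ n).mass : ℝ≥0∞)) (Filter.hyperfilter ℕ : Filter ℕ)
        (𝓝 (ν.mass : ℝ≥0∞)) :=
      (ENNReal.continuous_coe.tendsto _).comp ((FiniteMeasure.continuous_mass.tendsto ν).comp ht)
    rw [FiniteMeasure.ennreal_mass] at h2
    refine ge_of_tendsto h2 (Filter.Eventually.of_forall fun n ↦ ?_)
    rw [FiniteMeasure.ennreal_mass]
    exact (hmb n).le
  refine hνb.trans (le_newtonCap le_rfl ((hK 0).of_isClosed_subset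
    (isClosed_iInter fun n ↦ (hK n).isClosed) (iInter_subset _ 0)) ?_ fun x ↦ ?_)
  · rw [compl_iInter]; exact measure_iUnion_null hν0
  · exact newtonPotential_le_one_of_tendsto ht x fun n ↦ hmp n x

/-! ### Volumes of cubes and integrals of the Newtonian kernel -/

theorem volume_setOf_forall_mem {d : ℕ} {S : Fin d → Set ℝ} (hS : ∀ i, MeasurableSet (S i)) :
    volume {x : E d | ∀ i, x i ∈ S i} = ∏ i, volume (S i) := by
  have h := (PiLp.volume_preserving_ofLp (Fin d)).measure_preimage
    (s := Set.pi univ S) (MeasurableSet.univ_pi hS).nullMeasurableSet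
  rw [volume_pi_pi] at h
  rw [← h]
  congr 1
  ext x
  simp

theorem measurableSet_setOf_forall_mem {d : ℕ} {S : Fin d → Set ℝ}
    (hS : ∀ i, MeasurableSet (S i)) : MeasurableSet {x : E d | ∀ i, x i ∈ S i} := by
  rw [ofPred_forall]
  exact MeasurableSet.iInter fun i ↦ (by fun_prop : Measurable fun x : E d ↦ x i) (hS i)

theorem volume_cube {d : ℕ} (a : E d) (l : ℝ) : volume (cube a l) = ENNReal.ofReal l ^ d := by
  have := volume_setOf_forall_mem (d := d) (S := fun i ↦ Icc (a i) (a i + l))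
    fun i ↦ measurableSet_Icc
  simpa [cube] using this

theorem isClosed_cube {d : ℕ} (a : E d) (l : ℝ) : IsClosed (cube a l) := by
  unfold cube
  rw [ofPred_forall]
  refine isClosed_iInter fun i ↦ ?_
  exact (isClosed_Icc (a := a i) (b := a i + l)).preimage
    (by fun_prop : Continuous fun x : E d ↦ x i)

theorem volume_interior_cube {d : ℕ} (a : E d) (l : ℝ) :
    volume (interior (cube a l)) = ENNReal.ofReal l ^ d := by
  refine le_antisymm ((measure_mono interior_subset).trans (volume_cube a l).le) ?_
  have h := volume_setOf_forall_mem (d := d) (S := fun i ↦ Ioo (a i) (a i + l))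
    fun i ↦ measurableSet_Ioo
  have ho : IsOpen {x : E d | ∀ i, x i ∈ Ioo (a i) (a i + l)} := by
    rw [ofPred_forall]
    exact isOpen_iInter_of_finite fun i ↦
      isOpen_Ioo.preimage (by fun_prop : Continuous fun x : E d ↦ x i)
  have : volume {x : E d | ∀ i, x i ∈ Ioo (a i) (a i + l)} = ENNReal.ofReal l ^ d := by
    rw [h]; simp
  rw [← this]
  exact measure_mono (interior_maximal (fun x hx i ↦ ⟨(hx i).1.le, (hx i).2.le⟩) ho)

theorem dist_le_of_forall_abs_sub_le {d : ℕ} {x y : E d} {l : ℝ} (hl : 0 ≤ l)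
    (h : ∀ i, |x i - y i| ≤ l) : dist x y ≤ √d * l := by
  rw [EuclideanSpace.dist_eq]
  refine Real.sqrt_le_iff.2 ⟨by positivity, ?_⟩
  rw [mul_pow, Real.sq_sqrt (by positivity)]
  calc ∑ i, dist (x i) (y i) ^ 2 ≤ ∑ _i : Fin d, l ^ 2 := by
        refine Finset.sum_le_sum fun i _ ↦ ?_
        rw [Real.dist_eq]
        gcongr
        exact h i
    _ = d * l ^ 2 := by simp

theorem dist_le_of_mem_cube {d : ℕ} {a x y : E d} {l : ℝ} (hl : 0 ≤ l) (hx : x ∈ cube a l)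
    (hy : y ∈ cube a l) : dist x y ≤ √d * l :=
  dist_le_of_forall_abs_sub_le hl fun i ↦ by
    have := hx i; have := hy i
    rw [abs_le]; constructor <;> linarith

theorem isCompact_cube {d : ℕ} (a : E d) {l : ℝ} (hl : 0 ≤ l) : IsCompact (cube a l) := by
  refine Metric.isCompact_of_isClosed_isBounded (isClosed_cube a l) ?_
  exact Metric.isBounded_iff.2 ⟨√d * l, fun x hx y hy ↦ dist_le_of_mem_cube hl hx hy⟩

theorem volume_closedBall_eq {d : ℕ} [NeZero d] (x : E d) {R : ℝ} (hR : 0 ≤ R) :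
    volume (Metric.closedBall x R) =
      ENNReal.ofReal R ^ d * volume (Metric.closedBall (0 : E d) 1) := by
  rw [Measure.addHaar_closedBall' _ _ hR, ENNReal.ofReal_pow hR]
  simp

/-- The integral of `|y|^{2-d}` over the unit ball, which is finite. -/
def kernelIntegral (d : ℕ) : ℝ≥0∞ := ∫⁻ y in Metric.ball (0 : E d) 1, newtonKernel 0 y

theorem kernelIntegral_lt_top {d : ℕ} (hd : 3 ≤ d) : kernelIntegral d < ∞ := by
  have : NeZero d := ⟨by omega⟩
  have h1 : IntegrableOn (fun x : E d ↦ (fun r : ℝ ↦ (r ^ (d - 2))⁻¹) ‖x‖)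
      (Metric.ball 0 1) := by
    refine (integrableOn_fun_norm_addHaar volume (f := fun r : ℝ ↦ (r ^ (d - 2))⁻¹)).2 ?_
    have h2 : IntegrableOn (fun y : ℝ ↦ y) (Ioo 0 1) :=
      (continuous_id.integrableOn_Icc (a := (0 : ℝ)) (b := 1)).mono_set Ioo_subset_Icc_self
    refine h2.congr_fun (fun y hy ↦ ?_) measurableSet_Ioo
    have hy0 : y ≠ 0 := hy.1.ne'
    simp only [finrank_euclideanSpace, Fintype.card_fin, smul_eq_mul]
    rw [show d - 1 = (d - 2) + 1 by omega, pow_succ]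
    field_simp
  refine lt_of_eq_of_lt ?_ h1.2
  unfold kernelIntegral
  refine lintegral_congr_ae (ae_restrict_of_ae ?_)
  filter_upwards [compl_mem_ae_iff.2 (measure_singleton (0 : E d))] with y hy
  have hy0 : 0 < ‖y‖ := norm_pos_iff.2 hy
  unfold newtonKernel
  rw [edist_dist, dist_zero_left, Real.enorm_of_nonneg (by positivity),
    ENNReal.ofReal_inv_of_pos (by positivity), ENNReal.ofReal_pow hy0.le]

theorem lintegral_newtonKernel_ball {d : ℕ} (hd : 3 ≤ d) (x : E d) {t : ℝ} (ht : 0 < t) :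
    ∫⁻ y in Metric.ball x t, newtonKernel x y = ENNReal.ofReal t ^ 2 * kernelIntegral d := by
  have htE : ENNReal.ofReal t ≠ 0 := by simpa using ht
  have hsub : ∫⁻ y in Metric.ball x t, newtonKernel x y =
      ∫⁻ y, (Metric.ball 0 t).indicator (newtonKernel (0 : E d)) y := by
    rw [← lintegral_indicator Metric.isOpen_ball.measurableSet,
      ← lintegral_add_left_eq_self _ x]
    refine lintegral_congr fun y ↦ ?_
    simp [indicator, newtonKernel, edist_dist]
  have hmeas : Measurable ((Metric.ball 0 t).indicator (newtonKernel (0 : E d))) :=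
    (measurable_newtonKernel 0).indicator Metric.isOpen_ball.measurableSet
  have hscale := lintegral_map (μ := volume) hmeas
    (measurable_const_smul t : Measurable (t • · : E d → E d))
  rw [Measure.map_addHaar_smul _ ht.ne', lintegral_smul_measure] at hscale
  have hR : ∫⁻ y : E d, (Metric.ball 0 t).indicator (newtonKernel (0 : E d)) (t • y) =
      (ENNReal.ofReal t ^ (d - 2))⁻¹ * kernelIntegral d := by
    unfold kernelIntegral
    rw [← lintegral_indicator Metric.isOpen_ball.measurableSet,
      ← lintegral_const_mul _ ((measurable_newtonKernel 0).indicator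
        Metric.isOpen_ball.measurableSet)]
    refine lintegral_congr fun y ↦ ?_
    have hiff : t • y ∈ Metric.ball (0 : E d) t ↔ y ∈ Metric.ball (0 : E d) 1 := by
      simp [norm_smul, abs_of_pos ht, ht]
    by_cases hy : y ∈ Metric.ball (0 : E d) 1
    · rw [indicator_of_mem (hiff.2 hy), indicator_of_mem hy]
      unfold newtonKernel
      rw [edist_dist, edist_dist, dist_zero_left, dist_zero_left, norm_smul,
        Real.norm_of_nonneg ht.le, ENNReal.ofReal_mul ht.le, mul_pow,
        ENNReal.mul_inv (Or.inl (pow_ne_zero _ htE)) (Or.inl (by finiteness))]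
    · rw [indicator_of_notMem (fun h ↦ hy (hiff.1 h)), indicator_of_notMem hy, mul_zero]
  rw [hR] at hscale
  rw [hsub]
  have hpow : ENNReal.ofReal |(t ^ Module.finrank ℝ (E d))⁻¹| = (ENNReal.ofReal t ^ d)⁻¹ := by
    rw [abs_of_pos (by positivity), ENNReal.ofReal_inv_of_pos (by positivity),
      ENNReal.ofReal_pow ht.le]
    simp
  rw [hpow, smul_eq_mul] at hscale
  set I := ∫⁻ y, (Metric.ball 0 t).indicator (newtonKernel (0 : E d)) y
  set T := ENNReal.ofReal t
  have hT : T ≠ ∞ := ENNReal.ofReal_ne_top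
  calc I = T ^ d * ((T ^ d)⁻¹ * I) := by
        rw [← mul_assoc, ENNReal.mul_inv_cancel (pow_ne_zero _ htE) (by finiteness), one_mul]
    _ = T ^ d * ((T ^ (d - 2))⁻¹ * kernelIntegral d) := by rw [hscale]
    _ = T ^ 2 * kernelIntegral d := by
        have : T ^ d = T ^ 2 * T ^ (d - 2) := by rw [← pow_add]; congr 1; omega
        rw [this, ← mul_assoc, mul_assoc (T ^ 2),
          ENNReal.mul_inv_cancel (pow_ne_zero _ htE) (by finiteness), mul_one]

/-- The integral of the kernel over a set of volume at most `t^d`, wherever that set lies: within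
distance `t` of `x` the kernel is integrated over a whole ball, and beyond it is at most
`t^{2-d}`. -/
theorem lintegral_newtonKernel_le {d : ℕ} (hd : 3 ≤ d) (x : E d) {t : ℝ} (ht : 0 < t)
    {T : Set (E d)} (hT : volume T ≤ ENNReal.ofReal t ^ d) :
    ∫⁻ y in T, newtonKernel x y ≤ ENNReal.ofReal t ^ 2 * (kernelIntegral d + 1) := by
  have htE : ENNReal.ofReal t ≠ 0 := by simpa using ht
  calc ∫⁻ y in T, newtonKernel x y
      ≤ ∫⁻ y in Metric.ball x t ∪ T \ Metric.ball x t, newtonKernel x y :=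
        lintegral_mono_set (by rw [union_sdiff_self]; exact subset_union_right)
    _ ≤ (∫⁻ y in Metric.ball x t, newtonKernel x y) +
          ∫⁻ y in T \ Metric.ball x t, newtonKernel x y := lintegral_union_le _ _ _
    _ ≤ ENNReal.ofReal t ^ 2 * kernelIntegral d + ENNReal.ofReal t ^ 2 := by
        gcongr
        · exact (lintegral_newtonKernel_ball hd x ht).le
        calc ∫⁻ y in T \ Metric.ball x t, newtonKernel x y
            ≤ ∫⁻ _ in T \ Metric.ball x t, (ENNReal.ofReal t ^ (d - 2))⁻¹ := by
              refine lintegral_mono_ae ?_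
              have : ∀ᵐ y ∂volume.restrict (Metric.ball x t)ᶜ,
                  newtonKernel x y ≤ (ENNReal.ofReal t ^ (d - 2))⁻¹ := by
                refine ae_restrict_of_forall_mem Metric.isOpen_ball.measurableSet.compl
                  fun y hy ↦ ?_
                have : t ≤ dist y x := by simpa using hy
                unfold newtonKernel
                rw [edist_comm, edist_dist]
                gcongr
              exact ae_mono (Measure.restrict_mono (fun y hy ↦ hy.2) le_rfl) this
          _ = (ENNReal.ofReal t ^ (d - 2))⁻¹ * volume (T \ Metric.ball x t) := by
              rw [setLIntegral_const]
          _ ≤ (ENNReal.ofReal t ^ (d - 2))⁻¹ * ENNReal.ofReal t ^ d := by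
              gcongr
              exact (measure_mono sdiff_subset).trans hT
          _ = ENNReal.ofReal t ^ 2 := by
              rw [show d = (d - 2) + 2 by omega, pow_add, ← mul_assoc, Nat.add_sub_cancel,
                ENNReal.inv_mul_cancel (pow_ne_zero _ htE) (by finiteness), one_mul]
    _ = _ := by rw [mul_add, mul_one]

/-! ### A lower bound for the capacity of separated balls -/

/-- A cube with sides parallel to the axes is convex, so it contains its homothetic copies
centred at its own points. -/
theorem homothetic_cube_subset {d : ℕ} {a p : E d} {l r : ℝ} (hp : p ∈ cube a l)
    (hr1 : r ≤ 1) : cube (p + r • (a - p)) (r * l) ⊆ cube a l := by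
  intro x hx i
  have h1 := hx i
  have h2 := hp i
  simp only [PiLp.add_apply, PiLp.smul_apply, PiLp.sub_apply, smul_eq_mul] at h1
  constructor <;> nlinarith

theorem mem_homothetic_cube {d : ℕ} {a p : E d} {l r : ℝ} (hp : p ∈ cube a l)
    (hr0 : 0 ≤ r) : p ∈ cube (p + r • (a - p)) (r * l) := by
  intro i
  have h2 := hp i
  simp only [PiLp.add_apply, PiLp.smul_apply, PiLp.sub_apply, smul_eq_mul]
  constructor <;> nlinarith

/-- The constant in the capacity estimate `card_mul_le_newtonCap`. -/
def packingConst (d : ℕ) : ℝ≥0∞ :=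
  (kernelIntegral d + 1) *
    (ENNReal.ofReal (5 * √d) ^ d * volume (Metric.closedBall (0 : E d) 1) + 2 ^ (d - 2))

theorem packingConst_lt_top {d : ℕ} (hd : 3 ≤ d) : packingConst d < ∞ := by
  have h1 := kernelIntegral_lt_top hd
  have h2 : volume (Metric.closedBall (0 : E d) 1) < ∞ := measure_closedBall_lt_top
  unfold packingConst
  finiteness

theorem packingConst_ne_zero (d : ℕ) : packingConst d ≠ 0 := by
  unfold packingConst
  simp

theorem newtonKernel_le_two_pow_mul {d : ℕ} {x y z : E d} (h : dist x z ≤ 2 * dist x y) :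
    newtonKernel x y ≤ 2 ^ (d - 2) * newtonKernel x z := by
  unfold newtonKernel
  have h1 : edist x z ≤ 2 * edist x y := by
    have := ENNReal.ofReal_le_ofReal h
    rwa [ENNReal.ofReal_mul zero_le_two, ENNReal.ofReal_ofNat, ← edist_dist, ← edist_dist] at this
  have h2 : edist x z ^ (d - 2) ≤ 2 ^ (d - 2) * edist x y ^ (d - 2) := by
    rw [← mul_pow]; gcongr
  calc (edist x y ^ (d - 2))⁻¹
      = 2 ^ (d - 2) * (2 ^ (d - 2) * edist x y ^ (d - 2))⁻¹ := by
        rw [ENNReal.mul_inv (Or.inl (by simp)) (Or.inl (by finiteness)), ← mul_assoc,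
          ENNReal.mul_inv_cancel (by simp) (by finiteness), one_mul]
    _ ≤ _ := by gcongr

/-- The potential of a small cube `T` of side `t` close to a point `p` of a cell `S` of side `s`
is dominated by a quantity which is additive in the cell: the near part is charged to the
volume of the cell, the far part to the potential of the cell. -/
theorem lintegral_newtonKernel_le_cell {d : ℕ} (hd : 3 ≤ d) {t s : ℝ} (ht : 0 < t) (hts : t ≤ s)
    {S T : Set (E d)} (hS : MeasurableSet S) (hT : MeasurableSet T)
    (hSv : volume S = ENNReal.ofReal s ^ d)
    (hTv : volume T = ENNReal.ofReal t ^ d) {p : E d} (hSp : ∀ z ∈ S, dist z p ≤ √d * s)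
    (hTp : ∀ y ∈ T, dist y p ≤ √d * t) (x : E d) :
    ENNReal.ofReal s ^ d * ∫⁻ y in T, newtonKernel x y ≤
      ENNReal.ofReal t ^ 2 * (kernelIntegral d + 1) *
          volume (S ∩ Metric.closedBall x (5 * √d * s)) +
        ENNReal.ofReal t ^ d * 2 ^ (d - 2) * ∫⁻ z in S, newtonKernel x z := by
  have hd0 : 0 ≤ √(d : ℝ) := Real.sqrt_nonneg _
  by_cases hx : dist x p ≤ 4 * √d * s
  · refine le_trans ?_ le_self_add
    have : S ∩ Metric.closedBall x (5 * √d * s) = S := by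
      refine inter_eq_left.2 fun z hz ↦ ?_
      have h1 := hSp z hz
      have h2 := dist_triangle z p x
      rw [dist_comm p x] at h2
      rw [Metric.mem_closedBall]
      linarith
    rw [this, hSv, mul_comm]
    gcongr
    exact lintegral_newtonKernel_le hd x ht hTv.le
  · refine le_trans ?_ le_add_self
    push Not at hx
    have hcomp : ∀ y ∈ T, ENNReal.ofReal s ^ d * newtonKernel x y ≤
        2 ^ (d - 2) * ∫⁻ z in S, newtonKernel x z := by
      intro y hy
      rw [← hSv, mul_comm, ← setLIntegral_const,
        ← lintegral_const_mul _ (measurable_newtonKernel x)]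
      refine setLIntegral_mono' hS fun z hz ↦ newtonKernel_le_two_pow_mul ?_
      have h1 := hSp z hz
      have h2 := hTp y hy
      have h3 := dist_triangle x p z
      have h4 := dist_triangle x y p
      rw [dist_comm p z] at h3
      have h5 : √(d : ℝ) * t ≤ √d * s := by gcongr
      have h6 : 0 ≤ √(d : ℝ) * s := mul_nonneg hd0 (ht.le.trans hts)
      linarith
    calc ENNReal.ofReal s ^ d * ∫⁻ y in T, newtonKernel x y
        = ∫⁻ y in T, ENNReal.ofReal s ^ d * newtonKernel x y := by
          rw [lintegral_const_mul _ (measurable_newtonKernel x)]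
      _ ≤ ∫⁻ _ in T, 2 ^ (d - 2) * ∫⁻ z in S, newtonKernel x z := setLIntegral_mono' hT hcomp
      _ = _ := by rw [setLIntegral_const, hTv]; ring

/-- If a set contains balls of radius `√d t` around one point of each of finitely many disjoint
cells of side `s` in a cube of side `l`, and `t^{d-2} l² ≤ s^d`, then its capacity in the cube is
at least a constant times the sum `∑ t^{d-2}` of the capacities of the balls: the sum of suitable
uniform densities has a bounded potential. -/
theorem card_mul_le_newtonCap {d : ℕ} (hd : 3 ≤ d) {a : E d} {l t s : ℝ} (ht : 0 < t)
    (htl : t ≤ l) (hts : t ≤ s) (hcap : t ^ (d - 2) * l ^ 2 ≤ s ^ d) {ι : Type*} (J : Finset ι)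
    {S : ι → Set (E d)} (hS : ∀ i ∈ J, MeasurableSet (S i))
    (hdisj : (J : Set ι).PairwiseDisjoint S) (hsub : ∀ i ∈ J, S i ⊆ cube a l)
    (hvol : ∀ i ∈ J, volume (S i) = ENNReal.ofReal s ^ d)
    (hdiam : ∀ i ∈ J, ∀ x ∈ S i, ∀ y ∈ S i, dist x y ≤ √d * s)
    {p : ι → E d} (hp : ∀ i ∈ J, p i ∈ S i) {A : Set (E d)}
    (hA : ∀ i ∈ J, Metric.closedBall (p i) (√d * t) ⊆ A) :
    J.card * ENNReal.ofReal t ^ (d - 2) ≤ packingConst d * newtonCap (A ∩ cube a l) := by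
  have : NeZero d := ⟨by omega⟩
  have hl : 0 < l := ht.trans_le htl
  have hs : 0 < s := ht.trans_le hts
  have hr0 : 0 ≤ t / l := by positivity
  have hr1 : t / l ≤ 1 := (div_le_one hl).2 htl
  have hrl : t / l * l = t := div_mul_cancel₀ _ hl.ne'
  have htE : ENNReal.ofReal t ≠ 0 := by simpa using ht
  have hsE : ENNReal.ofReal s ≠ 0 := by simpa using hs
  -- the homothetic copy of the big cube with centre `p i` and side `t`: it lies both in the big
  -- cube and in the ball of radius `√d t` around `p i`
  set T : ι → Set (E d) := fun i ↦ cube (p i + (t / l) • (a - p i)) t with hTdef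
  have hTsub : ∀ i ∈ J, T i ⊆ cube a l := fun i hi ↦ by
    have := homothetic_cube_subset (hsub i hi (hp i hi)) hr1
    rwa [hrl] at this
  have hpT : ∀ i ∈ J, p i ∈ T i := fun i hi ↦ by
    have := mem_homothetic_cube (hsub i hi (hp i hi)) hr0
    rwa [hrl] at this
  have hTp : ∀ i ∈ J, ∀ y ∈ T i, dist y (p i) ≤ √d * t := fun i hi y hy ↦
    dist_le_of_mem_cube ht.le hy (hpT i hi)
  have hTm : ∀ i, MeasurableSet (T i) := fun i ↦ (isClosed_cube _ _).measurableSet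
  have hpot : ∀ x, ∑ i ∈ J, ∫⁻ y in T i, newtonKernel x y ≤
      packingConst d * ENNReal.ofReal t ^ 2 := by
    intro x
    have h1 : ENNReal.ofReal s ^ d * ∑ i ∈ J, ∫⁻ y in T i, newtonKernel x y ≤
        ENNReal.ofReal s ^ d * (packingConst d * ENNReal.ofReal t ^ 2) := by
      rw [Finset.mul_sum]
      calc ∑ i ∈ J, ENNReal.ofReal s ^ d * ∫⁻ y in T i, newtonKernel x y
          ≤ ∑ i ∈ J, (ENNReal.ofReal t ^ 2 * (kernelIntegral d + 1) *
              volume (S i ∩ Metric.closedBall x (5 * √d * s)) +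
            ENNReal.ofReal t ^ d * 2 ^ (d - 2) * ∫⁻ z in S i, newtonKernel x z) :=
            Finset.sum_le_sum fun i hi ↦ lintegral_newtonKernel_le_cell hd ht hts (hS i hi)
              (hTm i) (hvol i hi) (volume_cube _ _) (fun z hz ↦ hdiam i hi z hz _ (hp i hi))
              (hTp i hi) x
        _ = ENNReal.ofReal t ^ 2 * (kernelIntegral d + 1) *
              volume (⋃ i ∈ J, S i ∩ Metric.closedBall x (5 * √d * s)) +
            ENNReal.ofReal t ^ d * 2 ^ (d - 2) * ∫⁻ z in ⋃ i ∈ J, S i, newtonKernel x z := by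
            rw [Finset.sum_add_distrib, ← Finset.mul_sum, ← Finset.mul_sum,
              measure_biUnion_finset (fun i hi j hj hij ↦
                (hdisj hi hj hij).mono inter_subset_left inter_subset_left)
                fun i hi ↦ (hS i hi).inter Metric.isClosed_closedBall.measurableSet,
              lintegral_biUnion_finset hdisj hS]
        _ ≤ ENNReal.ofReal t ^ 2 * (kernelIntegral d + 1) *
              (ENNReal.ofReal (5 * √d) ^ d * ENNReal.ofReal s ^ d *
                volume (Metric.closedBall (0 : E d) 1)) +
            ENNReal.ofReal t ^ d * 2 ^ (d - 2) *
              (ENNReal.ofReal l ^ 2 * (kernelIntegral d + 1)) := by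
            gcongr
            · rw [← mul_pow, ← ENNReal.ofReal_mul (by positivity),
                ← volume_closedBall_eq x (by positivity)]
              exact measure_mono (iUnion₂_subset fun i _ ↦ inter_subset_right)
            · exact (lintegral_mono_set (iUnion₂_subset hsub)).trans
                (lintegral_newtonKernel_le hd x hl (volume_cube a l).le)
        _ = ENNReal.ofReal t ^ 2 * (kernelIntegral d + 1) *
              (ENNReal.ofReal (5 * √d) ^ d * volume (Metric.closedBall (0 : E d) 1)) *
                ENNReal.ofReal s ^ d +
            ENNReal.ofReal t ^ 2 * (kernelIntegral d + 1) * 2 ^ (d - 2) *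
              (ENNReal.ofReal t ^ (d - 2) * ENNReal.ofReal l ^ 2) := by
            rw [show ENNReal.ofReal t ^ d = ENNReal.ofReal t ^ 2 * ENNReal.ofReal t ^ (d - 2) by
              rw [← pow_add]; congr 1; omega]
            ring
        _ ≤ ENNReal.ofReal t ^ 2 * (kernelIntegral d + 1) *
              (ENNReal.ofReal (5 * √d) ^ d * volume (Metric.closedBall (0 : E d) 1)) *
                ENNReal.ofReal s ^ d +
            ENNReal.ofReal t ^ 2 * (kernelIntegral d + 1) * 2 ^ (d - 2) *
              ENNReal.ofReal s ^ d := by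
            gcongr
            rw [← ENNReal.ofReal_pow ht.le, ← ENNReal.ofReal_pow hl.le, ← ENNReal.ofReal_pow hs.le,
              ← ENNReal.ofReal_mul (by positivity)]
            exact ENNReal.ofReal_le_ofReal hcap
        _ = _ := by unfold packingConst; ring
    exact (ENNReal.mul_le_mul_iff_right (pow_ne_zero _ hsE) (by finiteness)).1 h1
  have hN0 := packingConst_ne_zero d
  have hNt := (packingConst_lt_top hd).ne
  set N := packingConst d
  -- the density of the competitor, the largest for which `hpot` gives a potential at most `1`
  set κ : ℝ≥0∞ := (N * ENNReal.ofReal t ^ 2)⁻¹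
  have hκ : κ * (N * ENNReal.ofReal t ^ 2) = 1 :=
    ENNReal.inv_mul_cancel (mul_ne_zero hN0 (pow_ne_zero _ htE)) (by finiteness)
  set m : Measure (E d) := ∑ i ∈ J, κ • volume.restrict (T i)
  have hmp : ∀ x, newtonPotential m x ≤ 1 := by
    intro x
    have : newtonPotential m x = κ * ∑ i ∈ J, ∫⁻ y in T i, newtonKernel x y := by
      unfold newtonPotential
      rw [lintegral_finsetSum_measure, Finset.mul_sum]
      simp
    rw [this, ← hκ]
    gcongr
    exact hpot x
  have hm0 : m (⋃ i ∈ J, T i)ᶜ = 0 := by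
    simp only [m, Measure.coe_finsetSum, Finset.sum_apply, Measure.smul_apply, smul_eq_mul]
    refine Finset.sum_eq_zero fun i hi ↦ ?_
    have : volume.restrict (T i) (⋃ i ∈ J, T i)ᶜ = 0 := by
      rw [Measure.restrict_apply' (hTm i)]
      refine measure_mono_null (t := ∅) ?_ measure_empty
      rintro y ⟨hy, hyT⟩
      exact hy (mem_iUnion₂.2 ⟨i, hi, hyT⟩)
    rw [this, mul_zero]
  have hK : IsCompact (⋃ i ∈ J, T i) := J.isCompact_biUnion fun i _ ↦ isCompact_cube _ ht.le
  have hKA : ⋃ i ∈ J, T i ⊆ A ∩ cube a l := iUnion₂_subset fun i hi ↦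
    subset_inter (fun y hy ↦ hA i hi (hTp i hi y hy)) (hTsub i hi)
  have hle := le_newtonCap hKA hK hm0 hmp
  have hmu : m univ = J.card * (κ * ENNReal.ofReal t ^ d) := by
    simp only [m, Measure.coe_finsetSum, Finset.sum_apply, Measure.smul_apply, smul_eq_mul,
      Measure.restrict_apply_univ]
    rw [Finset.sum_congr rfl fun i _ ↦ by rw [hTdef, volume_cube], Finset.sum_const, nsmul_eq_mul]
  calc J.card * ENNReal.ofReal t ^ (d - 2)
      = J.card * ENNReal.ofReal t ^ (d - 2) * (κ * (N * ENNReal.ofReal t ^ 2)) := by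
        rw [hκ, mul_one]
    _ = N * m univ := by
        rw [hmu, show ENNReal.ofReal t ^ d = ENNReal.ofReal t ^ (d - 2) * ENNReal.ofReal t ^ 2 by
          rw [← pow_add]; congr 1; omega]
        ring
    _ ≤ _ := by gcongr

/-! ### Subdivision of a cube -/

/-- The half-open cell with multi-index `j` in the grid with lowest corner `a` and mesh `s`. -/
def gridCell {d n : ℕ} (a : E d) (s : ℝ) (j : Fin d → Fin n) : Set (E d) :=
  {x | ∀ i, x i ∈ Ico (a i + s * (j i : ℕ)) (a i + s * (j i : ℕ) + s)}

section gridCell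

variable {d n : ℕ} {a : E d} {s : ℝ}

theorem measurableSet_gridCell (j : Fin d → Fin n) : MeasurableSet (gridCell a s j) :=
  measurableSet_setOf_forall_mem (S := fun i ↦ Ico (a i + s * (j i : ℕ)) (a i + s * (j i : ℕ) + s))
    fun _ ↦ measurableSet_Ico

theorem volume_gridCell (j : Fin d → Fin n) :
    volume (gridCell a s j) = ENNReal.ofReal s ^ d := by
  unfold gridCell
  rw [volume_setOf_forall_mem
    (S := fun i ↦ Ico (a i + s * (j i : ℕ)) (a i + s * (j i : ℕ) + s)) fun _ ↦ measurableSet_Ico]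
  simp

theorem dist_le_of_mem_gridCell (hs : 0 ≤ s) {j : Fin d → Fin n} {x y : E d}
    (hx : x ∈ gridCell a s j) (hy : y ∈ gridCell a s j) : dist x y ≤ √d * s :=
  dist_le_of_forall_abs_sub_le hs fun i ↦ by
    have := hx i; have := hy i
    simp only [mem_Ico] at *
    rw [abs_le]; constructor <;> linarith

theorem gridCell_subset_cube (hs : 0 ≤ s) (j : Fin d → Fin n) :
    gridCell a s j ⊆ cube a (n * s) := by
  intro x hx i
  obtain ⟨h1, h2⟩ := hx i
  have h3 : ((j i : ℕ) : ℝ) + 1 ≤ n := by exact_mod_cast (j i).2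
  have h4 : (0 : ℝ) ≤ (j i : ℕ) := by positivity
  constructor <;> nlinarith

theorem disjoint_gridCell (hs : 0 < s) {j j' : Fin d → Fin n} (h : j ≠ j') :
    Disjoint (gridCell a s j) (gridCell a s j') := by
  rw [Set.disjoint_left]
  intro x hx hx'
  apply h
  funext i
  obtain ⟨h1, h2⟩ := hx i
  obtain ⟨h3, h4⟩ := hx' i
  have h5 : ((j i : ℕ) : ℝ) < (j' i : ℕ) + 1 := by
    by_contra hcon; push Not at hcon; nlinarith
  have h6 : ((j' i : ℕ) : ℝ) < (j i : ℕ) + 1 := by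
    by_contra hcon; push Not at hcon; nlinarith
  have h7 : (j i : ℕ) < j' i + 1 := by exact_mod_cast h5
  have h8 : (j' i : ℕ) < j i + 1 := by exact_mod_cast h6
  exact Fin.ext (by omega)

/-- The cells fill the cube up to a null set, since their volumes add up. -/
theorem volume_cube_diff_iUnion_gridCell (hs : 0 < s) :
    volume (cube a (n * s) \ ⋃ j : Fin d → Fin n, gridCell a s j) = 0 := by
  have hU : ⋃ j : Fin d → Fin n, gridCell a s j ⊆ cube a (n * s) :=
    iUnion_subset fun j ↦ gridCell_subset_cube hs.le j
  have hv : volume (⋃ j : Fin d → Fin n, gridCell a s j) = volume (cube a (n * s)) := by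
    rw [measure_iUnion (fun j j' h ↦ disjoint_gridCell hs h) measurableSet_gridCell, tsum_fintype]
    simp_rw [volume_gridCell, volume_cube]
    rw [ENNReal.ofReal_mul (by positivity)]
    simp [mul_pow]
  rw [measure_sdiff hU (MeasurableSet.iUnion measurableSet_gridCell).nullMeasurableSet
    (by rw [hv, volume_cube]; finiteness), hv, tsub_self]

end gridCell

/-! ### Geometry of Whitney cubes -/

theorem convex_cube {d : ℕ} (a : E d) (l : ℝ) : Convex ℝ (cube a l) := by
  intro x hx y hy u v hu hv huv i
  have h1 := hx i
  have h2 := hy i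
  simp only [PiLp.add_apply, PiLp.smul_apply, smul_eq_mul]
  obtain rfl : v = 1 - u := by linarith
  constructor <;> nlinarith

theorem side_le_diam_cube {d : ℕ} [NeZero d] (a : E d) {l : ℝ} (hl : 0 ≤ l) :
    l ≤ Metric.diam (cube a l) := by
  have h1 : a ∈ cube a l := fun i ↦ ⟨le_rfl, by linarith⟩
  have h2 : a + EuclideanSpace.single 0 l ∈ cube a l := by
    intro i
    simp only [PiLp.add_apply, PiLp.single_apply]
    split_ifs <;> constructor <;> linarith
  have := Metric.dist_le_diam_of_mem (isCompact_cube a hl).isBounded h1 h2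
  simpa [abs_of_nonneg hl] using this

theorem exists_mem_unitSphere_dist_eq {d : ℕ} [NeZero d] {x : E d} (hx : x ∈ unitBall d) :
    ∃ y ∈ unitSphere d, dist x y = 1 - ‖x‖ := by
  have hx1 : ‖x‖ < 1 := by simpa [unitBall] using hx
  rcases eq_or_ne x 0 with rfl | h0
  · exact ⟨EuclideanSpace.single 0 1, by simp [unitSphere], by simp⟩
  · have hn : 0 < ‖x‖ := norm_pos_iff.2 h0
    refine ⟨‖x‖⁻¹ • x, by simp [unitSphere, norm_smul, hn.ne'], ?_⟩
    have : x - ‖x‖⁻¹ • x = (1 - ‖x‖⁻¹) • x := by rw [sub_smul, one_smul]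
    rw [dist_eq_norm, this, norm_smul, Real.norm_eq_abs, abs_of_nonpos, neg_sub, sub_mul,
      inv_mul_cancel₀ hn.ne', one_mul]
    have := (one_le_inv₀ hn).2 hx1.le
    linarith

theorem one_sub_norm_le_dist {d : ℕ} {y : E d} (hy : y ∈ unitSphere d) (x : E d) :
    1 - ‖x‖ ≤ dist y x := by
  have hy1 : ‖y‖ = 1 := by simpa [unitSphere] using hy
  have := norm_sub_norm_le y x
  rw [dist_eq_norm]; linarith

theorem setDist_le_dist {d : ℕ} {A B : Set (E d)} {x y : E d} (hx : x ∈ A) (hy : y ∈ B) :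
    setDist A B ≤ dist x y := by
  refine csInf_le ⟨0, ?_⟩ (mem_image2_of_mem hx hy)
  rintro _ ⟨u, -, v, -, rfl⟩
  exact dist_nonneg

namespace WhitneyDecomposition

variable {d : ℕ} (D : WhitneyDecomposition d) {k : ℕ} {x y : E d}

theorem isCompact_Q (k : ℕ) : IsCompact (D.Q k) := isCompact_cube _ (D.side_pos k).le

theorem measurableSet_Q (k : ℕ) : MeasurableSet (D.Q k) := (isClosed_cube _ _).measurableSet

theorem nonempty_Q (k : ℕ) : (D.Q k).Nonempty :=
  ⟨D.corner k, fun _ ↦ ⟨le_rfl, by linarith [D.side_pos k]⟩⟩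

theorem iUnion_Q : ⋃ k, D.Q k = unitBall d := D.iUnion_eq

theorem Q_subset_unitBall (k : ℕ) : D.Q k ⊆ unitBall d := by
  rw [← D.iUnion_Q]; exact subset_iUnion _ k

theorem diam_Q_pos [NeZero d] (k : ℕ) : 0 < Metric.diam (D.Q k) :=
  (D.side_pos k).trans_le (side_le_diam_cube _ (D.side_pos k).le)

theorem diam_Q_le_sqrt (k : ℕ) : Metric.diam (D.Q k) ≤ √d * D.side k :=
  Metric.diam_le_of_forall_dist_le (by have := D.side_pos k; positivity) fun _ hx _ hy ↦
    dist_le_of_mem_cube (D.side_pos k).le hx hy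

theorem dist_le_diam (hx : x ∈ D.Q k) (hy : y ∈ D.Q k) : dist x y ≤ Metric.diam (D.Q k) :=
  Metric.dist_le_diam_of_mem (D.isCompact_Q k).isBounded hx hy

theorem diam_Q_le [NeZero d] (hx : x ∈ D.Q k) : Metric.diam (D.Q k) ≤ 1 - ‖x‖ := by
  obtain ⟨y, hy, hxy⟩ := exists_mem_unitSphere_dist_eq (D.Q_subset_unitBall k hx)
  exact hxy ▸ (D.diam_le k).trans (setDist_le_dist hx hy)

theorem side_le [NeZero d] (hx : x ∈ D.Q k) : D.side k ≤ 1 - ‖x‖ :=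
  (side_le_diam_cube _ (D.side_pos k).le).trans (D.diam_Q_le hx)

theorem one_sub_norm_le [NeZero d] (hx : x ∈ D.Q k) : 1 - ‖x‖ ≤ 5 * √d * D.side k := by
  have h1 : 1 - ‖x‖ - Metric.diam (D.Q k) ≤ setDist (D.Q k) (unitSphere d) := by
    obtain ⟨y, hy, -⟩ := exists_mem_unitSphere_dist_eq (D.Q_subset_unitBall k hx)
    refine le_csInf ⟨_, mem_image2_of_mem hx hy⟩ ?_
    rintro _ ⟨u, hu, v, hv, rfl⟩
    have h2 := D.dist_le_diam hx hu
    have h3 := one_sub_norm_le_dist hv x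
    have h4 := dist_triangle x u v
    rw [dist_comm] at h3
    linarith
  have h2 : setDist (D.Q k) (unitSphere d) ≤ 4 * Metric.diam (D.Q k) := D.le_diam k
  have h3 := D.diam_Q_le_sqrt k
  linarith

theorem infDist_le (hx : x ∈ D.Q k) (τ : E d) : Metric.infDist τ (D.Q k) ≤ dist τ x :=
  Metric.infDist_le_dist_of_mem hx

theorem dist_le_two_mul_infDist (hx : x ∈ D.Q k) {τ : E d} (hτ : τ ∈ unitSphere d) :
    dist τ x ≤ 2 * Metric.infDist τ (D.Q k) := by
  obtain ⟨z, hz, hzd⟩ := (D.isCompact_Q k).exists_infDist_eq_dist (D.nonempty_Q k) τ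
  have h1 := D.dist_le_diam hz hx
  have h2 : Metric.diam (D.Q k) ≤ dist z τ := (D.diam_le k).trans (setDist_le_dist hz hτ)
  have h3 := dist_triangle τ z x
  rw [dist_comm z τ] at h2
  linarith

end WhitneyDecomposition

/-! ### Chains of balls -/

/-- Chaining: a function which is roughly constant on the balls `B(x, (1 - |x|) / 2)` varies at
most by the factor `C ^ N` along a segment that `N` such balls cover. -/
theorem le_pow_mul_of_dist_lt {d : ℕ} {C : ℝ} (hC : 1 < C) {f : E d → ℝ}
    (hf : ∀ x ∈ unitBall d, ∀ y ∈ Metric.ball x ((1 - ‖x‖) / 2), f y ≤ C * f x)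
    {K : Set (E d)} (hK : Convex ℝ K) {δ : ℝ} (hδ0 : 0 < δ) (hδ : ∀ z ∈ K, δ ≤ 1 - ‖z‖)
    {x y : E d} (hx : x ∈ K) (hy : y ∈ K) {N : ℕ} (hN : dist x y < N * (δ / 2)) :
    f y ≤ C ^ N * f x := by
  have hN0 : (0 : ℝ) < N := by
    by_contra h
    have : (N : ℝ) ≤ 0 := not_lt.1 h
    have h2 : (0 : ℝ) ≤ dist x y := dist_nonneg
    nlinarith
  have key : ∀ j : ℕ, j ≤ N → f (AffineMap.lineMap x y ((j : ℝ) / N)) ≤ C ^ j * f x := by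
    intro j
    induction j with
    | zero => intro _; simp
    | succ j ih =>
      intro hj
      have hzK : AffineMap.lineMap x y ((j : ℝ) / N) ∈ K :=
        hK.lineMap_mem hx hy ⟨by positivity, (div_le_one hN0).2 (by exact_mod_cast (by omega))⟩
      have hz := hδ _ hzK
      have hstep := hf (AffineMap.lineMap x y ((j : ℝ) / N))
        (by simp only [unitBall, Metric.mem_ball, dist_zero_right]; linarith)
        (AffineMap.lineMap x y (((j + 1 : ℕ) : ℝ) / N)) (by
          rw [Metric.mem_ball, dist_lineMap_lineMap, Real.dist_eq, ← sub_div, Nat.cast_succ,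
            add_sub_cancel_left, abs_of_pos (by positivity)]
          calc 1 / (N : ℝ) * dist x y < 1 / N * (N * (δ / 2)) := by gcongr
            _ = δ / 2 := by field_simp
            _ ≤ _ := by linarith)
      calc _ ≤ _ := hstep
        _ ≤ C * (C ^ j * f x) := by gcongr; exact ih (by omega)
        _ = _ := by ring
  have := key N le_rfl
  rwa [div_self hN0.ne', AffineMap.lineMap_apply_one] at this

theorem WhitneyDecomposition.le_pow_mul_of_mem {d : ℕ} [NeZero d] (D : WhitneyDecomposition d)
    {C : ℝ} (hC : 1 < C) {f : E d → ℝ}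
    (hf : ∀ x ∈ unitBall d, ∀ y ∈ Metric.ball x ((1 - ‖x‖) / 2), f y ≤ C * f x)
    {k : ℕ} {x y : E d} (hx : x ∈ D.Q k) (hy : y ∈ D.Q k) : f y ≤ C ^ 3 * f x := by
  refine le_pow_mul_of_dist_lt hC hf (convex_cube _ _) (D.diam_Q_pos k)
    (fun z hz ↦ D.diam_Q_le hz) hx hy ?_
  have h1 := D.dist_le_diam hx hy
  have h2 := D.diam_Q_pos k
  push_cast
  linarith

/-- The number of steps in a chain between two points of the closed ball of radius `ρ < 1`. -/
def chainLength (ρ : ℝ) : ℕ := ⌊4 / (1 - ρ)⌋₊ + 1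

theorem le_pow_chainLength_mul {d : ℕ} {C : ℝ} (hC : 1 < C) {f : E d → ℝ}
    (hf : ∀ x ∈ unitBall d, ∀ y ∈ Metric.ball x ((1 - ‖x‖) / 2), f y ≤ C * f x)
    {ρ : ℝ} (hρ : ρ < 1) {x y : E d} (hx : ‖x‖ ≤ ρ) (hy : ‖y‖ ≤ ρ) :
    f y ≤ C ^ chainLength ρ * f x := by
  refine le_pow_mul_of_dist_lt hC hf (convex_closedBall (0 : E d) ρ) (sub_pos.2 hρ)
    (fun z hz ↦ ?_) (by simpa using hx) (by simpa using hy) ?_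
  · have : ‖z‖ ≤ ρ := by simpa using hz
    linarith
  · have h1 : dist x y ≤ ‖x‖ + ‖y‖ := dist_le_norm_add_norm x y
    have h2 : 4 / (1 - ρ) < chainLength ρ := by
      have := Nat.lt_floor_add_one (4 / (1 - ρ))
      unfold chainLength
      exact_mod_cast this
    rw [div_lt_iff₀ (sub_pos.2 hρ)] at h2
    linarith

namespace Admissible

variable {d : ℕ} {C c M r : ℝ} {φ ν : E d → ℝ}

theorem radius_le_mul (h : Admissible C c M r φ ν) :
    ∀ x ∈ unitBall d, ∀ y ∈ Metric.ball x ((1 - ‖x‖) / 2), φ y ≤ C * φ x :=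
  fun x hx y hy ↦ (h.radius_comparable x hx y hy).2

theorem intensity_le_mul (h : Admissible C c M r φ ν) :
    ∀ x ∈ unitBall d, ∀ y ∈ Metric.ball x ((1 - ‖x‖) / 2), ν y ≤ C * ν x :=
  fun x hx y hy ↦ (h.intensity_comparable x hx y hy).2

theorem radius_le_max_mul (h : Admissible C c M r φ ν) {x : E d} (hx : x ∈ unitBall d) :
    φ x ≤ max c 0 * (1 - ‖x‖) := by
  have hx1 : ‖x‖ < 1 := by simpa [unitBall] using hx
  have := (div_le_iff₀ (by linarith)).1 (h.radius_le x hx)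
  exact this.trans (mul_le_mul_of_nonneg_right (le_max_left _ _) (by linarith))

end Admissible

/-- A bound for `(1 - |x|)² φ(x)^{d-2} ν(x)` on the whole ball: the hypothesis bounds it for
`|x| ≥ r`, and chains of balls carry the bound to `|x| < r`. -/
def densityBound (d : ℕ) (C M r : ℝ) : ℝ :=
  |M| + (C ^ chainLength r) ^ (d - 2) * C ^ chainLength r * (|M| / (1 - r) ^ 2)

theorem densityBound_nonneg {d : ℕ} {C M r : ℝ} (hC : 1 < C) : 0 ≤ densityBound d C M r := by
  have : 0 ≤ C := by linarith
  unfold densityBound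
  positivity

theorem Admissible.density_le {d : ℕ} [NeZero d] {C c M r : ℝ} {φ ν : E d → ℝ}
    (h : Admissible C c M r φ ν) (hC : 1 < C) (hr : r < 1) {x : E d} (hx : x ∈ unitBall d) :
    (1 - ‖x‖) ^ 2 * (φ x ^ (d - 2) * ν x) ≤ densityBound d C M r := by
  have hC0 : 0 ≤ C := by linarith
  have hx1 : ‖x‖ < 1 := by simpa [unitBall] using hx
  have hfar : ∀ y ∈ unitBall d, r ≤ ‖y‖ → (1 - ‖y‖) ^ 2 * (φ y ^ (d - 2) * ν y) ≤ |M| := by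
    intro y hy hry
    have hy1 : ‖y‖ < 1 := by simpa [unitBall] using hy
    have h1 := h.intensity_bound y hy hry
    have h2 : 0 < 1 - ‖y‖ := by linarith
    rw [mul_one_div, le_div_iff₀ h2] at h1
    calc _ = (1 - ‖y‖) * φ y ^ (d - 2) * ν y * (1 - ‖y‖) := by ring
      _ ≤ M := h1
      _ ≤ |M| := le_abs_self M
  unfold densityBound
  rcases le_or_gt r ‖x‖ with hrx | hrx
  · have : 0 ≤ (C ^ chainLength r) ^ (d - 2) * C ^ chainLength r * (|M| / (1 - r) ^ 2) := by
      positivity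
    linarith [hfar x hx hrx]
  · have hr0 : 0 < r := (norm_nonneg x).trans_lt hrx
    set y : E d := EuclideanSpace.single 0 r with hy
    have hyr : ‖y‖ = r := by simp [hy, abs_of_pos hr0]
    have hyb : y ∈ unitBall d := by simpa [unitBall, hyr] using hr
    have hφ := le_pow_chainLength_mul hC h.radius_le_mul hr hyr.le hrx.le
    have hν := le_pow_chainLength_mul hC h.intensity_le_mul hr hyr.le hrx.le
    have hφx := h.radius_nonneg x hx
    have hνx := h.intensity_nonneg x hx
    have hφy := h.radius_nonneg y hyb
    have hνy := h.intensity_nonneg y hyb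
    have hyM := hfar y hyb hyr.ge
    rw [hyr] at hyM
    have h1 : φ y ^ (d - 2) * ν y ≤ |M| / (1 - r) ^ 2 := by
      rw [le_div_iff₀ (by have := sub_pos.2 hr; positivity)]
      linarith
    have h2 : φ x ^ (d - 2) * ν x ≤
        (C ^ chainLength r) ^ (d - 2) * C ^ chainLength r * (|M| / (1 - r) ^ 2) := by
      calc φ x ^ (d - 2) * ν x
          ≤ (C ^ chainLength r * φ y) ^ (d - 2) * (C ^ chainLength r * ν y) := by gcongr
        _ = (C ^ chainLength r) ^ (d - 2) * C ^ chainLength r * (φ y ^ (d - 2) * ν y) := by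
            rw [mul_pow]; ring
        _ ≤ _ := by gcongr
    have h3 : (1 - ‖x‖) ^ 2 ≤ 1 := by
      have := norm_nonneg x
      exact pow_le_one₀ (by linarith) (by linarith)
    have h4 : 0 ≤ φ x ^ (d - 2) * ν x := by positivity
    have := abs_nonneg M
    nlinarith

/-! ### The Whitney cubes that meet a ball -/

/-- The constant in `WhitneyDecomposition.tsum_weight_le`. -/
def overlapConst (d : ℕ) (c : ℝ) : ℝ≥0∞ :=
  ENNReal.ofReal (4 * (2 / (1 - c)) ^ d * (15 * √d / (1 - c)) ^ d) *
    volume (Metric.closedBall (0 : E d) 1)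

theorem overlapConst_lt_top (d : ℕ) (c : ℝ) : overlapConst d c < ∞ :=
  ENNReal.mul_lt_top ENNReal.ofReal_lt_top measure_closedBall_lt_top

open scoped Classical in
/-- The weights of the Whitney cubes that meet the ball of centre `p` and radius
`s ≤ c (1 - |p|)` add up to at most a constant times `(1 - |p|)² / |τ - p|^d`. These cubes have
sides comparable with `1 - |p|` and lie in a ball of comparable radius, so that a comparison of
volumes bounds their number. -/
theorem WhitneyDecomposition.tsum_weight_le {d : ℕ} [NeZero d] (D : WhitneyDecomposition d)
    {c : ℝ} (hc0 : 0 ≤ c) (hc : c < 1) {τ : E d} (hτ : τ ∈ unitSphere d) {p : E d}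
    (hp : p ∈ unitBall d) {s : ℝ} (hs : s ≤ c * (1 - ‖p‖)) :
    ∑' k, (if Metric.infDist p (D.Q k) ≤ s then
        ENNReal.ofReal (D.side k ^ 2 / Metric.infDist τ (D.Q k) ^ d) else 0) ≤
      overlapConst d c * ENNReal.ofReal ((1 - ‖p‖) ^ 2 / ‖τ - p‖ ^ d) := by
  have hp1 : ‖p‖ < 1 := by simpa [unitBall] using hp
  have hδ : 0 < 1 - ‖p‖ := by linarith
  have hc1 : 0 < 1 - c := by linarith
  have hd0 : (0 : ℝ) < d := by exact_mod_cast Nat.pos_of_ne_zero (NeZero.ne d)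
  have hsd : 0 < √(d : ℝ) := Real.sqrt_pos.2 hd0
  set δ := 1 - ‖p‖
  set H : Set ℕ := {k | Metric.infDist p (D.Q k) ≤ s}
  have hτp : δ ≤ dist τ p := one_sub_norm_le_dist hτ p
  have hτp0 : 0 < dist τ p := hδ.trans_le hτp
  have hhit : ∀ k ∈ H, ∃ x ∈ D.Q k, dist p x ≤ c * δ := by
    intro k hk
    obtain ⟨x, hx, hxd⟩ := (D.isCompact_Q k).exists_infDist_eq_dist (D.nonempty_Q k) p
    exact ⟨x, hx, by rw [← hxd]; exact le_trans hk hs⟩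
  have hlow : ∀ {x : E d}, dist p x ≤ c * δ → (1 - c) * δ ≤ 1 - ‖x‖ ∧ 1 - ‖x‖ ≤ 2 * δ := by
    intro x hx
    have h1 := norm_sub_norm_le x p
    have h2 := norm_sub_norm_le p x
    rw [← dist_eq_norm] at h1 h2
    rw [dist_comm] at h1
    constructor
    · simp only [δ] at *; linarith
    · have : c * δ ≤ δ := by nlinarith
      simp only [δ] at *; linarith
  -- a lower bound for the sides of the cubes that meet the ball
  set v := (1 - c) * δ / (5 * √d) with hv
  have hv0 : 0 < v := by positivity
  have hweight : ∀ k ∈ H, D.side k ^ 2 / Metric.infDist τ (D.Q k) ^ d ≤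
      4 * (2 / (1 - c)) ^ d * (δ ^ 2 / ‖τ - p‖ ^ d) := by
    intro k hk
    obtain ⟨x, hx, hxp⟩ := hhit k hk
    have h1 : D.side k ≤ 2 * δ := (D.side_le hx).trans (hlow hxp).2
    have h2 := D.dist_le_two_mul_infDist hx hτ
    have h3 := dist_triangle_right τ p x
    have h4 : (1 - c) / 2 * ‖τ - p‖ ≤ Metric.infDist τ (D.Q k) := by
      rw [← dist_eq_norm]
      nlinarith
    have h5 : 0 < ‖τ - p‖ := by rwa [← dist_eq_norm]
    calc D.side k ^ 2 / Metric.infDist τ (D.Q k) ^ d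
        ≤ (2 * δ) ^ 2 / ((1 - c) / 2 * ‖τ - p‖) ^ d := by
          have := (D.side_pos k).le
          gcongr
      _ = _ := by
          rw [mul_pow, mul_pow, div_pow, div_pow]
          field_simp
          norm_num
  have hvol : ∀ k ∈ H, ENNReal.ofReal v ^ d ≤ volume (interior (D.Q k)) := by
    intro k hk
    obtain ⟨x, hx, hxp⟩ := hhit k hk
    unfold WhitneyDecomposition.Q
    rw [volume_interior_cube]
    gcongr
    rw [hv, div_le_iff₀ (by positivity)]
    linarith [D.one_sub_norm_le hx, (hlow hxp).1]
  have hsub : ∀ k ∈ H, interior (D.Q k) ⊆ Metric.closedBall p (3 * δ) := by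
    intro k hk y hy
    obtain ⟨x, hx, hxp⟩ := hhit k hk
    have h1 := D.dist_le_diam hx (interior_subset hy)
    have h2 := (D.diam_Q_le hx).trans (hlow hxp).2
    have h3 := dist_triangle p x y
    have : c * δ ≤ δ := by nlinarith
    rw [Metric.mem_closedBall, dist_comm]
    linarith
  set w := 4 * (2 / (1 - c)) ^ d * (δ ^ 2 / ‖τ - p‖ ^ d)
  have hvE : ENNReal.ofReal v ^ d ≠ 0 := pow_ne_zero _ (by simpa using hv0)
  have hvT : ENNReal.ofReal v ^ d ≠ ∞ := by finiteness
  have hcount : ENNReal.ofReal v ^ d * ∑' k, H.indicator (fun _ ↦ (1 : ℝ≥0∞)) k ≤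
      ENNReal.ofReal (3 * δ) ^ d * volume (Metric.closedBall (0 : E d) 1) := by
    rw [← ENNReal.tsum_mul_left]
    calc ∑' k, ENNReal.ofReal v ^ d * H.indicator (fun _ ↦ (1 : ℝ≥0∞)) k
        ≤ ∑' k, volume (if k ∈ H then interior (D.Q k) else ∅) := by
          refine ENNReal.tsum_le_tsum fun k ↦ ?_
          by_cases hk : k ∈ H
          · simpa [hk] using hvol k hk
          · simp [hk]
      _ = volume (⋃ k, if k ∈ H then interior (D.Q k) else ∅) := by
          refine (measure_iUnion (fun j k hjk ↦ ?_) fun k ↦ ?_).symm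
          · have := D.disjoint_interior j k hjk
            change Disjoint (if j ∈ H then interior (D.Q j) else ∅)
              (if k ∈ H then interior (D.Q k) else ∅)
            split_ifs
            · exact this
            all_goals simp
          · split_ifs
            · exact isOpen_interior.measurableSet
            · exact MeasurableSet.empty
      _ ≤ volume (Metric.closedBall p (3 * δ)) := by
          refine measure_mono (iUnion_subset fun k ↦ ?_)
          split_ifs with hk
          · exact hsub k hk
          · exact empty_subset _
      _ = _ := volume_closedBall_eq p (by positivity)
  have hratio : ENNReal.ofReal (3 * δ) ^ d =
      ENNReal.ofReal v ^ d * ENNReal.ofReal ((15 * √d / (1 - c)) ^ d) := by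
    rw [ENNReal.ofReal_pow (by positivity), ← mul_pow, ← ENNReal.ofReal_mul hv0.le]
    congr 2
    rw [hv]
    field_simp
    norm_num
  rw [hratio, mul_assoc, ENNReal.mul_le_mul_iff_right hvE hvT] at hcount
  calc _ ≤ ∑' k, ENNReal.ofReal w * H.indicator (fun _ ↦ (1 : ℝ≥0∞)) k := by
        refine ENNReal.tsum_le_tsum fun k ↦ ?_
        by_cases hk : k ∈ H
        · have hk' : Metric.infDist p (D.Q k) ≤ s := hk
          rw [if_pos hk', indicator_of_mem hk, mul_one]
          exact ENNReal.ofReal_le_ofReal (hweight k hk)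
        · have hk' : ¬ Metric.infDist p (D.Q k) ≤ s := hk
          rw [if_neg hk']
          exact zero_le
    _ = ENNReal.ofReal w * ∑' k, H.indicator (fun _ ↦ (1 : ℝ≥0∞)) k := ENNReal.tsum_mul_left
    _ ≤ ENNReal.ofReal w * (ENNReal.ofReal ((15 * √d / (1 - c)) ^ d) *
          volume (Metric.closedBall (0 : E d) 1)) := by gcongr
    _ = _ := by
        unfold overlapConst
        rw [ENNReal.ofReal_mul (p := 4 * (2 / (1 - c)) ^ d) (by positivity),
          ENNReal.ofReal_mul (p := 4 * (2 / (1 - c)) ^ d) (by positivity)]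
        ring

/-! ### Poisson point processes -/

theorem lintegral_natCast_poissonMeasure (r : ℝ≥0) :
    ∫⁻ n : ℕ, (n : ℝ≥0∞) ∂poissonMeasure r = r := by
  have hsum : ∑' n : ℕ, ENNReal.ofReal (Real.exp (-r) * r ^ n / n.factorial) = 1 := by
    rw [← ENNReal.ofReal_tsum_of_nonneg (fun n ↦ by positivity)
      (hasSum_one_poissonMeasure r).summable, (hasSum_one_poissonMeasure r).tsum_eq,
      ENNReal.ofReal_one]
  unfold poissonMeasure
  rw [lintegral_sum_measure]
  simp only [lintegral_smul_measure, lintegral_dirac, smul_eq_mul]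
  rw [tsum_eq_zero_add' ENNReal.summable, Nat.cast_zero, mul_zero, zero_add]
  have hterm : ∀ n : ℕ, ENNReal.ofReal (Real.exp (-r) * r ^ (n + 1) / (n + 1).factorial) *
      ((n + 1 : ℕ) : ℝ≥0∞) = r * ENNReal.ofReal (Real.exp (-r) * r ^ n / n.factorial) := by
    intro n
    rw [← ENNReal.ofReal_natCast, ← ENNReal.ofReal_coe_nnreal, ← ENNReal.ofReal_mul (by positivity),
      ← ENNReal.ofReal_mul (by positivity)]
    congr 1
    rw [Nat.factorial_succ]
    push_cast
    field_simp
    ring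
  rw [tsum_congr hterm, ENNReal.tsum_mul_left, hsum, mul_one]

theorem pointCount_eq_zero_iff {Ω X : Type*} {𝓟 : Ω → Set X} {A : Set X} {ω : Ω} :
    pointCount 𝓟 A ω = 0 ↔ 𝓟 ω ∩ A = ∅ := encard_eq_zero

namespace IsPoissonProcess

variable {Ω X : Type*} [MeasurableSpace Ω] [MeasurableSpace X] {P : Measure Ω}
  {S : Set X} {μ : Measure X} {𝓟 : Ω → Set X}

theorem lintegral_pointCount [IsProbabilityMeasure P] (h : IsPoissonProcess P S μ 𝓟)
    {A : Set X} (hAS : A ⊆ S) (hA : MeasurableSet A) : ∫⁻ ω, (pointCount 𝓟 A ω : ℝ≥0∞) ∂P = μ A := by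
  by_cases hμ : μ A = ∞
  · have : ∀ᵐ ω ∂P, (pointCount 𝓟 A ω : ℝ≥0∞) = ∞ := by
      filter_upwards [h.law_top A hAS hA hμ] with ω hω
      rw [hω]; rfl
    rw [lintegral_congr_ae this, hμ]
    simp
  · have hm : Measurable fun n : ℕ∞ ↦ (n : ℝ≥0∞) := Measurable.of_discrete
    rw [← lintegral_map hm (h.measurable A hAS hA), h.law A hAS hA hμ,
      lintegral_map hm Measurable.of_discrete]
    simp only [ENat.toENNReal_coe]
    rw [lintegral_natCast_poissonMeasure, ENNReal.coe_toNNReal hμ]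

theorem measure_pointCount_eq_zero (h : IsPoissonProcess P S μ 𝓟) {A : Set X} (hAS : A ⊆ S)
    (hA : MeasurableSet A) (hμ : μ A ≠ ∞) :
    P {ω | pointCount 𝓟 A ω = 0} = ENNReal.ofReal (Real.exp (-(μ A).toReal)) := by
  have h1 : P {ω | pointCount 𝓟 A ω = 0} = P.map (pointCount 𝓟 A) {0} := by
    rw [Measure.map_apply (h.measurable A hAS hA) (measurableSet_singleton 0)]
    rfl
  have h2 : (fun n : ℕ ↦ (n : ℕ∞)) ⁻¹' {0} = {0} := by ext n; simp
  rw [h1, h.law A hAS hA hμ, Measure.map_apply Measurable.of_discrete (measurableSet_singleton 0),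
    h2, poissonMeasure_singleton]
  simp [ENNReal.coe_toNNReal_eq_toReal]

/-- A set of bounded mean measure is occupied with a probability comparable to its mean measure,
since `1 - exp (-u) ≥ u / (1 + u)`. -/
theorem measure_le_mul_measure_pointCount_ne_zero [IsProbabilityMeasure P]
    (h : IsPoissonProcess P S μ 𝓟) {A : Set X} (hAS : A ⊆ S)
    (hA : MeasurableSet A) {B : ℝ} (hB : 0 ≤ B) (hμ : μ A ≤ ENNReal.ofReal B) :
    μ A ≤ ENNReal.ofReal (1 + B) * P {ω | pointCount 𝓟 A ω ≠ 0} := by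
  have hfin : μ A ≠ ∞ := (hμ.trans_lt ENNReal.ofReal_lt_top).ne
  have hmeas : MeasurableSet {ω | pointCount 𝓟 A ω = 0} :=
    h.measurable A hAS hA (measurableSet_singleton 0)
  have hcompl : {ω | pointCount 𝓟 A ω ≠ 0} = {ω | pointCount 𝓟 A ω = 0}ᶜ := rfl
  rw [hcompl, prob_compl_eq_one_sub hmeas, h.measure_pointCount_eq_zero hAS hA hfin,
    ← ENNReal.ofReal_one, ← ENNReal.ofReal_sub _ (Real.exp_nonneg _),
    ← ENNReal.ofReal_mul (by linarith), ← ENNReal.ofReal_toReal hfin,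
    ENNReal.toReal_ofReal ENNReal.toReal_nonneg]
  refine ENNReal.ofReal_le_ofReal ?_
  have hu0 : 0 ≤ (μ A).toReal := ENNReal.toReal_nonneg
  have huB : (μ A).toReal ≤ B := ENNReal.toReal_le_of_le_ofReal hB hμ
  set u := (μ A).toReal
  have h1 : Real.exp (-u) * (u + 1) ≤ 1 := by
    calc Real.exp (-u) * (u + 1) ≤ Real.exp (-u) * Real.exp u := by
          gcongr; exact Real.add_one_le_exp u
      _ = 1 := by rw [← Real.exp_add]; simp
  have h2 : Real.exp (-u) ≤ 1 := Real.exp_le_one_iff.2 (by linarith)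
  nlinarith

/-- Campbell's formula, with the measurability of the sum over the configuration. -/
theorem measurable_tsum_and_lintegral_tsum [IsProbabilityMeasure P]
    (h : IsPoissonProcess P S μ 𝓟) (hS : MeasurableSet S)
    {f : X → ℝ≥0∞} (hf : Measurable f) :
    Measurable (fun ω ↦ ∑' p : 𝓟 ω, f p) ∧
      ∫⁻ ω, ∑' p : 𝓟 ω, f p ∂P = ∫⁻ x in S, f x ∂μ := by
  refine Measurable.ennreal_induction (motive := fun f ↦ Measurable (fun ω ↦ ∑' p : 𝓟 ω, f p) ∧
    ∫⁻ ω, ∑' p : 𝓟 ω, f p ∂P = ∫⁻ x in S, f x ∂μ) ?_ ?_ ?_ hf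
  · intro c A hA
    have hcount : ∀ ω, ∑' p : 𝓟 ω, A.indicator (fun _ ↦ c) p =
        c * (pointCount 𝓟 (A ∩ S) ω : ℝ≥0∞) := by
      intro ω
      have : 𝓟 ω ∩ (A ∩ S) = 𝓟 ω ∩ A := by
        have := h.subset ω
        grind
      rw [tsum_subtype (𝓟 ω) (A.indicator fun _ ↦ c), indicator_indicator, ← tsum_subtype,
        ENNReal.tsum_const, pointCount, this, mul_comm]
      rfl
    have hm := h.measurable (A ∩ S) inter_subset_right (hA.inter hS)
    have hm' : Measurable fun ω ↦ (pointCount 𝓟 (A ∩ S) ω : ℝ≥0∞) :=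
      (Measurable.of_discrete : Measurable fun n : ℕ∞ ↦ (n : ℝ≥0∞)).comp hm
    simp_rw [hcount]
    refine ⟨hm'.const_mul c, ?_⟩
    rw [lintegral_const_mul _ hm', h.lintegral_pointCount inter_subset_right (hA.inter hS),
      lintegral_indicator_const hA, Measure.restrict_apply hA]
  · intro f g _ hf hg ihf ihg
    have hadd : ∀ ω, ∑' p : 𝓟 ω, (f + g) p = (∑' p : 𝓟 ω, f p) + ∑' p : 𝓟 ω, g p :=
      fun ω ↦ ENNReal.tsum_add
    simp_rw [hadd]
    refine ⟨ihf.1.add ihg.1, ?_⟩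
    rw [lintegral_add_left ihf.1, ihf.2, ihg.2, ← lintegral_add_left hf]
    rfl
  · intro f hf hmono ih
    -- the sum over the configuration is an integral against a sum of Dirac masses, to which
    -- monotone convergence applies
    have hsup : ∀ ω, ∑' p : 𝓟 ω, ⨆ n, f n p = ⨆ n, ∑' p : 𝓟 ω, f n p := by
      intro ω
      have hint : ∀ g : X → ℝ≥0∞, Measurable g →
          ∑' p : 𝓟 ω, g p = ∫⁻ x, g x ∂Measure.sum fun p : 𝓟 ω ↦ Measure.dirac (p : X) := by
        intro g hg
        rw [lintegral_sum_measure]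
        exact tsum_congr fun p ↦ (lintegral_dirac' _ hg).symm
      rw [hint _ (Measurable.iSup hf), lintegral_iSup hf hmono]
      exact iSup_congr fun n ↦ (hint _ (hf n)).symm
    simp_rw [hsup]
    refine ⟨Measurable.iSup fun n ↦ (ih n).1, ?_⟩
    rw [lintegral_iSup (fun n ↦ (ih n).1) fun m n hmn ω ↦ ENNReal.tsum_le_tsum fun p ↦ hmono hmn _,
      lintegral_iSup hf hmono]
    exact iSup_congr fun n ↦ (ih n).2

theorem ae_finite_inter [IsProbabilityMeasure P] (h : IsPoissonProcess P S μ 𝓟)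
    {A : Set X} (hAS : A ⊆ S) (hA : MeasurableSet A) (hμ : μ A ≠ ∞) : ∀ᵐ ω ∂P, (𝓟 ω ∩ A).Finite := by
  have hm : Measurable fun ω ↦ (pointCount 𝓟 A ω : ℝ≥0∞) :=
    (Measurable.of_discrete : Measurable fun n : ℕ∞ ↦ (n : ℝ≥0∞)).comp (h.measurable A hAS hA)
  filter_upwards [ae_lt_top hm (by rwa [h.lintegral_pointCount hAS hA])] with ω hω
  rw [← encard_ne_top_iff]
  intro htop
  rw [pointCount, htop] at hω
  exact lt_irrefl _ hω

end IsPoissonProcess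

/-! ### Measurability of the capacity of the archipelago -/

/-- Outer continuity for a finite union of balls whose radii decrease to their limits. -/
theorem iInf_newtonCap_iUnion_closedBall_le {d : ℕ} {F : Set (E d)} (hF : F.Finite) {φ : E d → ℝ}
    {Q : Set (E d)} (hQ : IsCompact Q) {ε : ℕ → ℝ} (hanti : Antitone ε)
    (hε : Filter.Tendsto ε Filter.atTop (𝓝 0)) :
    ⨅ n, newtonCap ((⋃ p ∈ F, Metric.closedBall p (φ p + ε n)) ∩ Q) ≤
      newtonCap ((⋃ p ∈ F, Metric.closedBall p (φ p)) ∩ Q) := by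
  refine (iInf_newtonCap_le (K := fun n ↦ (⋃ p ∈ F, Metric.closedBall p (φ p + ε n)) ∩ Q)
    (fun n ↦ (hF.isCompact_biUnion fun p _ ↦ isCompact_closedBall _ _).inter hQ)
    fun m n hmn ↦ ?_).trans (newtonCap_mono fun x hx ↦ ?_)
  · have := hanti hmn
    refine inter_subset_inter_left _ (biUnion_mono le_rfl fun p _ ↦ ?_)
    exact Metric.closedBall_subset_closedBall (by linarith)
  · rw [mem_iInter] at hx
    refine ⟨?_, (hx 0).2⟩
    by_contra hcon
    simp only [mem_iUnion, Metric.mem_closedBall, not_exists, not_le] at hcon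
    have h1 : ∀ p ∈ F, ∀ᶠ n in Filter.atTop, φ p + ε n < dist x p := by
      intro p hp
      have : Filter.Tendsto (fun n ↦ φ p + ε n) Filter.atTop (𝓝 (φ p + 0)) :=
        tendsto_const_nhds.add hε
      rw [add_zero] at this
      exact this.eventually_lt_const (hcon p hp)
    obtain ⟨n, hn⟩ := ((hF.eventually_all).2 h1).exists
    obtain ⟨p, hp, hxp⟩ := mem_iUnion₂.1 (hx n).1
    exact absurd (hn p hp) (not_lt.2 hxp)

/-- The points of the unit ball whose balls of radius `φ` meet `Q`. -/
def reachSet {d : ℕ} (φ : E d → ℝ) (Q : Set (E d)) : Set (E d) :=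
  unitBall d ∩ {p | Metric.infDist p Q ≤ φ p}

theorem measurableSet_reachSet {d : ℕ} {φ : E d → ℝ} (hφ : Measurable φ) (Q : Set (E d)) :
    MeasurableSet (reachSet φ Q) :=
  Metric.isOpen_ball.measurableSet.inter
    (measurableSet_le (Metric.continuous_infDist_pt Q).measurable hφ)

theorem archipelago_inter_eq {d : ℕ} (φ : E d → ℝ) {𝓠 : Set (E d)} (h𝓠 : 𝓠 ⊆ unitBall d)
    (Q : Set (E d)) : archipelago φ 𝓠 ∩ Q =
      (⋃ p ∈ 𝓠 ∩ reachSet φ Q, Metric.closedBall p (φ p)) ∩ Q := by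
  refine Subset.antisymm (fun x ⟨hx, hxQ⟩ ↦ ⟨?_, hxQ⟩)
    (inter_subset_inter_left _ (biUnion_subset_biUnion_left inter_subset_left))
  obtain ⟨p, hp, hxp⟩ := mem_iUnion₂.1 hx
  refine mem_iUnion₂.2 ⟨p, ⟨hp, h𝓠 hp, ?_⟩, hxp⟩
  rw [Metric.mem_closedBall, dist_comm] at hxp
  exact (Metric.infDist_le_dist_of_mem hxQ).trans hxp

/-- The capacity of the part of the archipelago in a compact set depends measurably on the
configuration. A finite family of small measurable sets covers the relevant pairs of centres and
radii; replacing each occupied set by one slightly larger ball gives upper approximations which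
depend on finitely many events, and outer continuity shows that they converge. -/
theorem IsPoissonProcess.aemeasurable_newtonCap {d : ℕ} {Ω : Type*} [MeasurableSpace Ω]
    {P : Measure Ω} [IsProbabilityMeasure P] {μ : Measure (E d)} {𝓟 : Ω → Set (E d)}
    (h : IsPoissonProcess P (unitBall d) μ 𝓟) {φ : E d → ℝ} (hφ : Measurable φ)
    (hφ1 : ∀ x ∈ unitBall d, φ x ∈ Icc 0 1) {Q : Set (E d)} (hQ : IsCompact Q)
    (hμ : μ (reachSet φ Q) ≠ ∞) :
    AEMeasurable (fun ω ↦ newtonCap (archipelago φ (𝓟 ω) ∩ Q)) P := by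
  classical
  set R := reachSet φ Q
  have hR : MeasurableSet R := measurableSet_reachSet hφ Q
  have hRS : R ⊆ unitBall d := inter_subset_left
  set f : E d → E d × ℝ := fun p ↦ (p, φ p)
  have hf : Measurable f := measurable_id.prodMk hφ
  have hbdd : TotallyBounded (f '' R) := by
    refine ((isCompact_closedBall (0 : E d) 1).prod
      (isCompact_Icc (a := (0 : ℝ)) (b := 1))).totallyBounded.subset ?_
    rintro _ ⟨p, hp, rfl⟩
    exact ⟨Metric.ball_subset_closedBall (hRS hp), hφ1 p (hRS hp)⟩
  set ε : ℕ → ℝ := fun n ↦ 1 / ((n : ℝ) + 1)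
  have hε0 : ∀ n, 0 < ε n := fun n ↦ Nat.one_div_pos_of_nat
  choose t htf ht using fun n ↦ Metric.totallyBounded_iff.1 hbdd (ε n) (hε0 n)
  let cell : ℕ → E d × ℝ → Set (E d) := fun n y ↦ R ∩ f ⁻¹' Metric.ball y (ε n)
  have hcell : ∀ n y, MeasurableSet (cell n y) := fun n y ↦
    hR.inter (hf Metric.isOpen_ball.measurableSet)
  let G : (n : ℕ) → (t n → Prop) → ℝ≥0∞ := fun n O ↦
    newtonCap ((⋃ (y : t n) (_ : O y),
      Metric.closedBall (y : E d × ℝ).1 ((y : E d × ℝ).2 + 2 * ε n)) ∩ Q)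
  let O : (n : ℕ) → Ω → t n → Prop := fun n ω y ↦ pointCount 𝓟 (cell n y) ω ≠ 0
  have hO : ∀ n, Measurable (O n) := by
    intro n
    refine measurable_pi_iff.2 fun y ↦ measurableSet_setOfPred.1 ?_
    exact h.measurable (cell n y) (inter_subset_left.trans hRS) (hcell n y)
      (measurableSet_singleton 0).compl
  have hG : ∀ n, Measurable fun ω ↦ G n (O n ω) := by
    intro n
    have := (htf n).to_subtype
    exact (Measurable.of_discrete : Measurable (G n)).comp (hO n)
  refine ⟨fun ω ↦ ⨅ n, G n (O n ω), Measurable.iInf hG, ?_⟩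
  filter_upwards [h.ae_finite_inter hRS hR hμ] with ω hfin
  rw [archipelago_inter_eq φ (h.subset ω) Q]
  refine le_antisymm (le_iInf fun n ↦ newtonCap_mono (inter_subset_inter_left _ ?_)) ?_
  · refine iUnion₂_subset fun p hp ↦ ?_
    obtain ⟨y, hy, hpy⟩ := mem_iUnion₂.1 (ht n (mem_image_of_mem f hp.2))
    refine subset_iUnion₂_of_subset ⟨y, hy⟩ ?_ ?_
    · exact fun h0 ↦ (pointCount_eq_zero_iff.1 h0).subset ⟨hp.1, hp.2, hpy⟩
    · rw [Metric.mem_ball, Prod.dist_eq, max_lt_iff, Real.dist_eq, abs_lt] at hpy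
      exact Metric.closedBall_subset_closedBall' (by
        have h1 : dist p y.1 < ε n := hpy.1
        have h2 : φ p - y.2 < ε n := hpy.2.2
        change φ p + dist p y.1 ≤ y.2 + 2 * ε n
        linarith)
  · have hanti : Antitone fun n ↦ 4 * ε n := fun m n hmn ↦
      mul_le_mul_of_nonneg_left (Nat.one_div_le_one_div hmn) (by norm_num)
    have hlim : Filter.Tendsto (fun n ↦ 4 * ε n) Filter.atTop (𝓝 0) := by
      simpa [ε] using (tendsto_one_div_add_atTop_nhds_zero_nat (𝕜 := ℝ)).const_mul 4
    refine le_trans (iInf_mono fun n ↦ newtonCap_mono (inter_subset_inter_left _ ?_))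
      (iInf_newtonCap_iUnion_closedBall_le hfin hQ hanti hlim)
    refine iUnion₂_subset fun y hy ↦ ?_
    obtain ⟨p, hp, hpR, hpy⟩ := nonempty_iff_ne_empty.2 fun h0 ↦ hy (pointCount_eq_zero_iff.2 h0)
    refine subset_iUnion₂_of_subset p ⟨hp, hpR⟩ ?_
    rw [mem_preimage, Metric.mem_ball, Prod.dist_eq, max_lt_iff, Real.dist_eq, abs_lt] at hpy
    exact Metric.closedBall_subset_closedBall' (by
      have h1 : dist p (y : E d × ℝ).1 < ε n := hpy.1
      have h2 : -ε n < φ p - (y : E d × ℝ).2 := hpy.2.1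
      rw [dist_comm] at h1
      linarith)

/-! ### Expected capacity of the archipelago in a Whitney cube -/

section Expectation

variable {d : ℕ} {C c M r : ℝ} {φ ν : E d → ℝ} {Ω : Type*} [MeasurableSpace Ω]
  {P : Measure Ω} [IsProbabilityMeasure P] {𝓟 : Ω → Set (E d)}

theorem Admissible.radius_mem_Icc (h : Admissible C c M r φ ν) (hc : c < 1) {x : E d}
    (hx : x ∈ unitBall d) : φ x ∈ Icc 0 (1 - ‖x‖) := by
  have hx1 : ‖x‖ < 1 := by simpa [unitBall] using hx
  refine ⟨h.radius_nonneg x hx, (h.radius_le_max_mul hx).trans ?_⟩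
  exact mul_le_of_le_one_left (by linarith) (max_le hc.le zero_le_one)

theorem Admissible.intensityMeasure_reachSet_ne_top [NeZero d]
    (h : Admissible C c M r φ ν) (hC : 1 < C)
    (hc : c < 1) (D : WhitneyDecomposition d) (k : ℕ) :
    intensityMeasure ν (reachSet φ (D.Q k)) ≠ ∞ := by
  have hside := D.side_pos k
  set ρ := 1 - D.side k / 2 with hρ
  have hρ1 : ρ < 1 := by linarith
  have hreach : ∀ p ∈ reachSet φ (D.Q k), ‖p‖ ≤ ρ := by
    intro p hp
    obtain ⟨x, hx, hxd⟩ := (D.isCompact_Q k).exists_infDist_eq_dist (D.nonempty_Q k) p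
    have h1 : dist p x ≤ φ p := by rw [← hxd]; exact hp.2
    have h2 := (h.radius_mem_Icc hc hp.1).2
    have h3 := D.side_le hx
    have h4 := norm_sub_norm_le p x
    rw [← dist_eq_norm] at h4
    linarith
  have hbound : ∀ p ∈ reachSet φ (D.Q k), ν p ≤ C ^ chainLength ρ * ν 0 := fun p hp ↦
    le_pow_chainLength_mul hC h.intensity_le_mul hρ1
      (by rw [norm_zero]; exact (norm_nonneg p).trans (hreach p hp)) (hreach p hp)
  unfold intensityMeasure
  rw [withDensity_apply _ (measurableSet_reachSet h.measurable_radius _)]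
  refine ((setLIntegral_mono' (measurableSet_reachSet h.measurable_radius _) fun p hp ↦
    ENNReal.ofReal_le_ofReal (hbound p hp)).trans_lt ?_).ne
  rw [setLIntegral_const]
  exact ENNReal.mul_lt_top ENNReal.ofReal_lt_top
    ((measure_mono inter_subset_left).trans_lt measure_ball_lt_top)

theorem Admissible.aemeasurable_newtonCap [NeZero d]
    (h : Admissible C c M r φ ν) (hC : 1 < C) (hc : c < 1)
    (hP : IsPoissonProcess P (unitBall d) (intensityMeasure ν) 𝓟) (D : WhitneyDecomposition d)
    (k : ℕ) : AEMeasurable (fun ω ↦ newtonCap (archipelago φ (𝓟 ω) ∩ D.Q k)) P :=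
  hP.aemeasurable_newtonCap h.measurable_radius
    (fun x hx ↦ Icc_subset_Icc_right (by linarith [norm_nonneg x]) (h.radius_mem_Icc hc hx))
    (D.isCompact_Q k) (h.intensityMeasure_reachSet_ne_top hC hc D k)

/-- The upper bound: capacity is subadditive, and Campbell's formula computes the expected sum of
the capacities of the balls that meet the cube. -/
theorem Admissible.lintegral_newtonCap_le [NeZero d]
    (h : Admissible C c M r φ ν) (hC : 1 < C) (hc : c < 1)
    (hP : IsPoissonProcess P (unitBall d) (intensityMeasure ν) 𝓟) (D : WhitneyDecomposition d)
    (k : ℕ) : ∫⁻ ω, newtonCap (archipelago φ (𝓟 ω) ∩ D.Q k) ∂P ≤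
      ∫⁻ x in unitBall d, (reachSet φ (D.Q k)).indicator
        (fun x ↦ ENNReal.ofReal (φ x) ^ (d - 2)) x ∂intensityMeasure ν := by
  set R := reachSet φ (D.Q k)
  have hR : MeasurableSet R := measurableSet_reachSet h.measurable_radius _
  have hg : Measurable (R.indicator fun x ↦ ENNReal.ofReal (φ x) ^ (d - 2)) :=
    (h.measurable_radius.ennreal_ofReal.pow_const _).indicator hR
  rw [← (hP.measurable_tsum_and_lintegral_tsum Metric.isOpen_ball.measurableSet hg).2]
  refine lintegral_mono_ae ?_
  filter_upwards [hP.ae_finite_inter inter_subset_left hR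
    (h.intensityMeasure_reachSet_ne_top hC hc D k)] with ω hfin
  have hcount : Countable ↥(𝓟 ω ∩ R) := hfin.countable.to_subtype
  rw [archipelago_inter_eq φ (hP.subset ω), biUnion_eq_iUnion]
  calc _ ≤ newtonCap (⋃ p : ↥(𝓟 ω ∩ R), Metric.closedBall (p : E d) (φ p)) :=
        newtonCap_mono inter_subset_left
    _ ≤ ∑' p : ↥(𝓟 ω ∩ R), newtonCap (Metric.closedBall (p : E d) (φ p)) :=
        newtonCap_iUnion_le fun p ↦ Metric.isClosed_closedBall
    _ ≤ ∑' p : ↥(𝓟 ω ∩ R), ENNReal.ofReal (φ p) ^ (d - 2) :=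
        ENNReal.tsum_le_tsum fun p ↦ newtonCap_closedBall_le _ _
    _ = _ := by
        rw [tsum_subtype (𝓟 ω ∩ R) fun x ↦ ENNReal.ofReal (φ x) ^ (d - 2),
          tsum_subtype (𝓟 ω) (R.indicator _), indicator_indicator]

theorem exists_nat_pow_le_lt {x : ℝ} (hx : 1 ≤ x) {m : ℕ} (hm : m ≠ 0) :
    ∃ n : ℕ, 1 ≤ n ∧ (n : ℝ) ^ m ≤ x ∧ x < ((n : ℝ) + 1) ^ m := by
  classical
  have hex : ∃ n : ℕ, x < ((n : ℝ) + 1) ^ m := by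
    obtain ⟨n, hn⟩ := exists_nat_gt x
    refine ⟨n, hn.trans_le ?_⟩
    calc (n : ℝ) ≤ n + 1 := by linarith
      _ ≤ ((n : ℝ) + 1) ^ m := le_self_pow₀ (by linarith [Nat.cast_nonneg (α := ℝ) n]) hm
  have h0 : Nat.find hex ≠ 0 := by
    intro h0
    have := Nat.find_spec hex
    rw [h0] at this
    norm_num at this
    linarith
  obtain ⟨n, hn⟩ := Nat.exists_eq_succ_of_ne_zero h0
  refine ⟨Nat.find hex, by omega, ?_, Nat.find_spec hex⟩
  have := Nat.find_min hex (m := n) (by omega)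
  rw [hn]
  push_cast
  exact not_lt.1 this

/-- The constant in the lower bound `Admissible.le_lintegral_newtonCap`. -/
def lowerConst (d : ℕ) (C M r : ℝ) : ℝ≥0∞ :=
  ENNReal.ofReal ((5 * √d * (C ^ 3 * C ^ 3)) ^ (d - 2)) *
    (ENNReal.ofReal (1 + C ^ 3 * (2 ^ d * densityBound d C M r)) * packingConst d)

theorem lowerConst_lt_top {d : ℕ} (hd : 3 ≤ d) (C M r : ℝ) : lowerConst d C M r < ∞ :=
  ENNReal.mul_lt_top ENNReal.ofReal_lt_top
    (ENNReal.mul_lt_top ENNReal.ofReal_lt_top (packingConst_lt_top hd))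

/-- The capacity estimate for one point in each occupied cell of a grid, averaged: the expected
number of occupied cells is comparable to the mean measure of the cube when the cells have bounded
mean measure. -/
theorem IsPoissonProcess.measure_cube_le {μ : Measure (E d)} (hd : 3 ≤ d) (hμ : μ ≪ volume)
    (hP : IsPoissonProcess P (unitBall d) μ 𝓟) {a : E d} {s t : ℝ} {n : ℕ} (ht : 0 < t)
    (hts : t ≤ s) (htn : t ≤ n * s) (hcap : t ^ (d - 2) * (n * s) ^ 2 ≤ s ^ d)
    (hsub : cube a (n * s) ⊆ unitBall d) (hφ : ∀ x ∈ cube a (n * s), √d * t ≤ φ x) {B : ℝ}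
    (hB : 0 ≤ B) (hcell : ∀ j : Fin d → Fin n, μ (gridCell a s j) ≤ ENNReal.ofReal B) :
    ENNReal.ofReal t ^ (d - 2) * μ (cube a (n * s)) ≤ ENNReal.ofReal (1 + B) * packingConst d *
      ∫⁻ ω, newtonCap (archipelago φ (𝓟 ω) ∩ cube a (n * s)) ∂P := by
  classical
  have hs : 0 < s := ht.trans_le hts
  have hcube : ∀ j : Fin d → Fin n, gridCell a s j ⊆ cube a (n * s) := gridCell_subset_cube hs.le
  have hcb : ∀ j : Fin d → Fin n, gridCell a s j ⊆ unitBall d := fun j ↦ (hcube j).trans hsub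
  set O : (Fin d → Fin n) → Set Ω := fun j ↦ {ω | pointCount 𝓟 (gridCell a s j) ω ≠ 0}
  have hO : ∀ j, MeasurableSet (O j) := fun j ↦
    hP.measurable _ (hcb j) (measurableSet_gridCell j) (measurableSet_singleton 0).compl
  have hμQ : μ (cube a (n * s)) ≤ ∑ j : Fin d → Fin n, μ (gridCell a s j) := by
    calc μ (cube a (n * s))
        ≤ μ ((cube a (n * s) \ ⋃ j : Fin d → Fin n, gridCell a s j) ∪
            ⋃ j : Fin d → Fin n, gridCell a s j) :=
          measure_mono (by rw [sdiff_union_self]; exact subset_union_left)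
      _ ≤ 0 + ∑ j : Fin d → Fin n, μ (gridCell a s j) := by
          refine (measure_union_le _ _).trans (add_le_add ?_ ?_)
          · exact (hμ (volume_cube_diff_iUnion_gridCell hs)).le
          · exact measure_iUnion_fintype_le _ _
      _ = _ := zero_add _
  have hpt : ∀ ω, ENNReal.ofReal t ^ (d - 2) *
      ∑ j : Fin d → Fin n, (O j).indicator (fun _ ↦ (1 : ℝ≥0∞)) ω ≤
        packingConst d * newtonCap (archipelago φ (𝓟 ω) ∩ cube a (n * s)) := by
    intro ω
    set J : Finset (Fin d → Fin n) := Finset.univ.filter fun j ↦ ω ∈ O j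
    have hJ : ∀ j, j ∈ J → (𝓟 ω ∩ gridCell a s j).Nonempty := by
      intro j hj
      have hj' : ω ∈ O j := (Finset.mem_filter.1 hj).2
      exact nonempty_iff_ne_empty.2 fun h0 ↦ hj' (pointCount_eq_zero_iff.2 h0)
    choose! p hp using hJ
    have hsum : ∑ j : Fin d → Fin n, (O j).indicator (fun _ ↦ (1 : ℝ≥0∞)) ω = J.card := by
      have : (J.card : ℝ≥0∞) = ∑ j, if ω ∈ O j then 1 else 0 := by rw [Finset.sum_boole]
      rw [this]
      exact Finset.sum_congr rfl fun j _ ↦ by by_cases hj : ω ∈ O j <;> simp [hj]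
    rw [hsum, mul_comm]
    refine card_mul_le_newtonCap hd ht htn hts hcap J (fun j _ ↦ measurableSet_gridCell j)
      (fun i _ j _ hij ↦ disjoint_gridCell hs hij) (fun j _ ↦ hcube j)
      (fun j _ ↦ volume_gridCell j)
      (fun j _ x hx y hy ↦ dist_le_of_mem_gridCell hs.le hx hy)
      (fun j hj ↦ (hp j hj).2) fun j hj ↦ ?_
    exact (Metric.closedBall_subset_closedBall (hφ _ (hcube j (hp j hj).2))).trans
      (subset_biUnion_of_mem (u := fun p ↦ Metric.closedBall p (φ p)) (hp j hj).1)
  calc ENNReal.ofReal t ^ (d - 2) * μ (cube a (n * s))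
      ≤ ENNReal.ofReal t ^ (d - 2) *
          ∑ j : Fin d → Fin n, ENNReal.ofReal (1 + B) * P (O j) := by
        gcongr
        refine hμQ.trans (Finset.sum_le_sum fun j _ ↦ ?_)
        exact hP.measure_le_mul_measure_pointCount_ne_zero (hcb j) (measurableSet_gridCell j) hB
          (hcell j)
    _ = ENNReal.ofReal (1 + B) * ∫⁻ ω, ENNReal.ofReal t ^ (d - 2) *
          ∑ j : Fin d → Fin n, (O j).indicator (fun _ ↦ (1 : ℝ≥0∞)) ω ∂P := by
        rw [lintegral_const_mul _ (Finset.measurable_fun_sum _ fun j _ ↦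
          measurable_const.indicator (hO j)), lintegral_finsetSum _ fun j _ ↦
          measurable_const.indicator (hO j)]
        simp_rw [lintegral_indicator_const (hO _), one_mul]
        rw [← Finset.mul_sum]
        ring
    _ ≤ ENNReal.ofReal (1 + B) *
          ∫⁻ ω, packingConst d * newtonCap (archipelago φ (𝓟 ω) ∩ cube a (n * s)) ∂P := by
        exact mul_le_mul_right (lintegral_mono hpt) _
    _ = _ := by
        rw [lintegral_const_mul' _ _ (packingConst_lt_top hd).ne, mul_assoc]

/-- The lower bound. The mesh `s` of the grid is chosen with `s^d` comparable to `t^{d-2} l²`,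
where `t` is comparable to the radii in the cube: this is just large enough for balls in distinct
cells to have capacities that add up, and by the bound on the intensity the cells still have
bounded mean measure, so that occupied cells are as frequent as points. -/
theorem Admissible.le_lintegral_newtonCap [NeZero d]
    (h : Admissible C c M r φ ν) (hd : 3 ≤ d) (hC : 1 < C)
    (hc : c < 1) (hr : r < 1) (hP : IsPoissonProcess P (unitBall d) (intensityMeasure ν) 𝓟)
    (D : WhitneyDecomposition d) (k : ℕ) :
    ∫⁻ x in D.Q k, ENNReal.ofReal (φ x ^ (d - 2) * ν x) ≤
      lowerConst d C M r * ∫⁻ ω, newtonCap (archipelago φ (𝓟 ω) ∩ D.Q k) ∂P := by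
  have hx0 : D.corner k ∈ D.Q k := fun _ ↦ ⟨le_rfl, by linarith [D.side_pos k]⟩
  set x0 := D.corner k
  set l := D.side k
  have hl : 0 < l := D.side_pos k
  have hx0b := D.Q_subset_unitBall k hx0
  have hC3 : 1 ≤ C ^ 3 := one_le_pow₀ hC.le
  have hφle : ∀ x ∈ D.Q k, φ x ≤ C ^ 3 * φ x0 := fun x hx ↦
    D.le_pow_mul_of_mem hC h.radius_le_mul hx0 hx
  have hφge : ∀ x ∈ D.Q k, φ x0 ≤ C ^ 3 * φ x := fun x hx ↦
    D.le_pow_mul_of_mem hC h.radius_le_mul hx hx0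
  have hνle : ∀ x ∈ D.Q k, ν x ≤ C ^ 3 * ν x0 := fun x hx ↦
    D.le_pow_mul_of_mem hC h.intensity_le_mul hx0 hx
  have hφ0 := h.radius_nonneg _ hx0b
  have hν0 := h.intensity_nonneg _ hx0b
  have hQm := D.measurableSet_Q k
  rcases hφ0.eq_or_lt with hzero | hpos
  -- if `φ` vanishes at one point of the cube, it vanishes on the whole cube
  · have : ∫⁻ x in D.Q k, ENNReal.ofReal (φ x ^ (d - 2) * ν x) = 0 := by
      rw [setLIntegral_congr_fun hQm (g := fun _ ↦ 0), lintegral_zero]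
      intro x hx
      have h1 := hφle x hx
      rw [← hzero, mul_zero] at h1
      have h2 : φ x = 0 := le_antisymm h1 (h.radius_nonneg x (D.Q_subset_unitBall k hx))
      simp only [h2]
      rw [zero_pow (by omega), zero_mul, ENNReal.ofReal_zero]
    rw [this]
    exact zero_le
  have hd0 : (0 : ℝ) < d := by exact_mod_cast (by omega : 0 < d)
  have hsd : 1 ≤ √(d : ℝ) := Real.one_le_sqrt.2 (by exact_mod_cast (by omega : 1 ≤ d))
  have hsd0 : 0 < √(d : ℝ) := by linarith
  -- small enough for `t ≤ l` and for the balls of radius `√d t` to lie in those of radius `φ`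
  set t := φ x0 / (5 * √d * C ^ 3) with htdef
  have ht : 0 < t := by positivity
  have hφt : φ x0 = t * (5 * √d * C ^ 3) := by rw [htdef]; field_simp
  have htφ : t ≤ φ x0 := by
    rw [htdef]
    refine div_le_self hφ0 ?_
    nlinarith
  have htl : t ≤ l := by
    rw [htdef, div_le_iff₀ (by positivity)]
    calc φ x0 ≤ 1 - ‖x0‖ := (h.radius_mem_Icc hc hx0b).2
      _ ≤ 5 * √d * l := D.one_sub_norm_le hx0
      _ ≤ 5 * √d * l * C ^ 3 := le_mul_of_one_le_right (by positivity) hC3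
      _ = _ := by ring
  have htφx : ∀ x ∈ D.Q k, √d * t ≤ φ x := by
    intro x hx
    have h1 := hφge x hx
    rw [hφt] at h1
    have h2 : t * (5 * √d) ≤ φ x := by
      have : (t * (5 * √d)) * C ^ 3 ≤ φ x * C ^ 3 := by linarith
      exact le_of_mul_le_mul_right this (by linarith)
    nlinarith
  -- the finest grid for which the mesh `s = l / n` satisfies `t^{d-2} l² ≤ s^d`
  obtain ⟨n, hn1, hnle, hnlt⟩ := exists_nat_pow_le_lt (x := l ^ (d - 2) / t ^ (d - 2))
    ((one_le_div (by positivity)).2 (by gcongr)) (by omega : d ≠ 0)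
  have hn0 : (0 : ℝ) < n := by exact_mod_cast hn1
  rw [le_div_iff₀ (by positivity)] at hnle
  rw [div_lt_iff₀ (by positivity)] at hnlt
  set s := l / n with hsdef
  have hns : n * s = l := mul_div_cancel₀ l hn0.ne'
  have hs : 0 < s := by positivity
  have hpow : ∀ y : ℝ, y ^ d = y ^ (d - 2) * y ^ 2 := fun y ↦ by
    rw [← pow_add]; congr 1; omega
  have hsn : s ^ d = l ^ d / (n : ℝ) ^ d := by rw [hsdef, div_pow]
  have hcap : t ^ (d - 2) * l ^ 2 ≤ s ^ d := by
    rw [hsn, le_div_iff₀ (by positivity), hpow l]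
    nlinarith [sq_nonneg l]
  have hts : t ≤ s := by
    refine le_of_pow_le_pow_left₀ (by omega : d ≠ 0) hs.le (le_trans ?_ hcap)
    rw [hpow t]
    gcongr
  have hsup : s ^ d ≤ 2 ^ d * (t ^ (d - 2) * l ^ 2) := by
    rw [hsn, div_le_iff₀ (by positivity), hpow l]
    have h1 : ((n : ℝ) + 1) ^ d ≤ (2 * n) ^ d := by
      have : (1 : ℝ) ≤ n := by exact_mod_cast hn1
      gcongr
      linarith
    rw [mul_pow] at h1
    have h2 : l ^ (d - 2) ≤ 2 ^ d * (n : ℝ) ^ d * t ^ (d - 2) :=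
      hnlt.le.trans (by gcongr)
    calc l ^ (d - 2) * l ^ 2 ≤ 2 ^ d * (n : ℝ) ^ d * t ^ (d - 2) * l ^ 2 := by gcongr
      _ = _ := by ring
  set B := C ^ 3 * (2 ^ d * densityBound d C M r) with hBdef
  have hdens0 : 0 ≤ densityBound d C M r := densityBound_nonneg hC
  have hB0 : 0 ≤ B := by positivity
  -- the maximality of `n` and the bound on the intensity keep the mean measure of a cell bounded
  have hνs : C ^ 3 * ν x0 * s ^ d ≤ B := by
    have h1 := h.density_le hC hr hx0b
    have h2 : l ≤ 1 - ‖x0‖ := D.side_le hx0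
    calc C ^ 3 * ν x0 * s ^ d ≤ C ^ 3 * ν x0 * (2 ^ d * (φ x0 ^ (d - 2) * (1 - ‖x0‖) ^ 2)) := by
          gcongr
          refine hsup.trans ?_
          gcongr
      _ = C ^ 3 * (2 ^ d * ((1 - ‖x0‖) ^ 2 * (φ x0 ^ (d - 2) * ν x0))) := by ring
      _ ≤ B := by rw [hBdef]; gcongr
  have hQc : D.Q k = cube x0 (n * s) := by rw [hns]; rfl
  have hνE : ∀ x ∈ D.Q k, ENNReal.ofReal (ν x) ≤ ENNReal.ofReal (C ^ 3 * ν x0) := fun x hx ↦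
    ENNReal.ofReal_le_ofReal (hνle x hx)
  have hcell : ∀ j : Fin d → Fin n, intensityMeasure ν (gridCell x0 s j) ≤ ENNReal.ofReal B := by
    intro j
    unfold intensityMeasure
    rw [withDensity_apply _ (measurableSet_gridCell j)]
    calc ∫⁻ x in gridCell x0 s j, ENNReal.ofReal (ν x)
        ≤ ∫⁻ _ in gridCell x0 s j, ENNReal.ofReal (C ^ 3 * ν x0) :=
          setLIntegral_mono' (measurableSet_gridCell j) fun x hx ↦
            hνE x (by rw [hQc]; exact gridCell_subset_cube hs.le j hx)
      _ = ENNReal.ofReal (C ^ 3 * ν x0 * s ^ d) := by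
          rw [setLIntegral_const, volume_gridCell, ← ENNReal.ofReal_pow hs.le,
            ← ENNReal.ofReal_mul (by positivity)]
      _ ≤ _ := ENNReal.ofReal_le_ofReal hνs
  have key := hP.measure_cube_le (φ := φ) (a := x0) hd (withDensity_absolutelyContinuous _ _) ht hts
    (by rwa [hns]) (by rwa [hns]) (by rw [← hQc]; exact D.Q_subset_unitBall k)
    (by rwa [← hQc]) hB0 hcell
  rw [← hQc] at key
  calc ∫⁻ x in D.Q k, ENNReal.ofReal (φ x ^ (d - 2) * ν x)
      ≤ ∫⁻ x in D.Q k, ENNReal.ofReal ((C ^ 3 * φ x0) ^ (d - 2)) * ENNReal.ofReal (ν x) := by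
        refine setLIntegral_mono' hQm fun x hx ↦ ?_
        have hxb := D.Q_subset_unitBall k hx
        have h1 := h.radius_nonneg x hxb
        rw [ENNReal.ofReal_mul (by positivity)]
        gcongr
        exact hφle x hx
    _ = ENNReal.ofReal ((5 * √d * (C ^ 3 * C ^ 3)) ^ (d - 2)) *
          (ENNReal.ofReal t ^ (d - 2) * intensityMeasure ν (D.Q k)) := by
        rw [lintegral_const_mul _ h.measurable_intensity.ennreal_ofReal, intensityMeasure,
          withDensity_apply _ hQm, ← mul_assoc, ← ENNReal.ofReal_pow ht.le,
          ← ENNReal.ofReal_mul (by positivity), ← mul_pow, hφt]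
        congr 3
        ring
    _ ≤ ENNReal.ofReal ((5 * √d * (C ^ 3 * C ^ 3)) ^ (d - 2)) *
          (ENNReal.ofReal (1 + B) * packingConst d *
            ∫⁻ ω, newtonCap (archipelago φ (𝓟 ω) ∩ D.Q k) ∂P) := mul_le_mul_right key _
    _ = _ := by unfold lowerConst; ring

end Expectation

/-! ### Summation over the Whitney decomposition -/

section Summation

variable {d : ℕ} {C c M r : ℝ} {φ ν : E d → ℝ} {Ω : Type*} [MeasurableSpace Ω]
  {P : Measure Ω} [IsProbabilityMeasure P] {𝓟 : Ω → Set (E d)} {τ : E d}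

theorem Admissible.aemeasurable_aikawaSeries [NeZero d]
    (h : Admissible C c M r φ ν) (hC : 1 < C)
    (hc : c < 1) (hP : IsPoissonProcess P (unitBall d) (intensityMeasure ν) 𝓟)
    (D : WhitneyDecomposition d) (τ : E d) :
    AEMeasurable (fun ω ↦ aikawaSeries D (archipelago φ (𝓟 ω)) τ) P :=
  AEMeasurable.tsum fun k ↦ (h.aemeasurable_newtonCap hC hc hP D k).const_mul _

theorem Admissible.lintegral_aikawaSeries [NeZero d]
    (h : Admissible C c M r φ ν) (hC : 1 < C)
    (hc : c < 1) (hP : IsPoissonProcess P (unitBall d) (intensityMeasure ν) 𝓟)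
    (D : WhitneyDecomposition d) (τ : E d) :
    ∫⁻ ω, aikawaSeries D (archipelago φ (𝓟 ω)) τ ∂P =
      ∑' k, ENNReal.ofReal (D.side k ^ 2 / Metric.infDist τ (D.Q k) ^ d) *
        ∫⁻ ω, newtonCap (archipelago φ (𝓟 ω) ∩ D.Q k) ∂P := by
  unfold aikawaSeries
  rw [lintegral_tsum fun k ↦ (h.aemeasurable_newtonCap hC hc hP D k).const_mul _]
  exact tsum_congr fun k ↦ lintegral_const_mul' _ _ ENNReal.ofReal_ne_top

theorem Admissible.lintegral_aikawaSeries_le [NeZero d]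
    (h : Admissible C c M r φ ν) (hC : 1 < C)
    (hc : c < 1) (hP : IsPoissonProcess P (unitBall d) (intensityMeasure ν) 𝓟)
    (D : WhitneyDecomposition d) (hτ : τ ∈ unitSphere d) :
    ∫⁻ ω, aikawaSeries D (archipelago φ (𝓟 ω)) τ ∂P ≤
      overlapConst d (max c 0) * poissonBalayage φ ν τ := by
  classical
  have hball : MeasurableSet (unitBall d) := Metric.isOpen_ball.measurableSet
  rw [h.lintegral_aikawaSeries hC hc hP]
  set w : ℕ → ℝ≥0∞ := fun k ↦ ENNReal.ofReal (D.side k ^ 2 / Metric.infDist τ (D.Q k) ^ d)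
  set g : E d → ℝ≥0∞ := fun x ↦ ENNReal.ofReal (φ x) ^ (d - 2)
  have hgm : Measurable g := h.measurable_radius.ennreal_ofReal.pow_const _
  have hRm : ∀ k, MeasurableSet (reachSet φ (D.Q k)) := fun k ↦
    measurableSet_reachSet h.measurable_radius _
  have hm : ∀ k, Measurable fun x ↦ w k * (reachSet φ (D.Q k)).indicator g x := fun k ↦
    (hgm.indicator (hRm k)).const_mul _
  calc ∑' k, w k * ∫⁻ ω, newtonCap (archipelago φ (𝓟 ω) ∩ D.Q k) ∂P
      ≤ ∑' k, w k * ∫⁻ x in unitBall d, (reachSet φ (D.Q k)).indicator g x ∂intensityMeasure ν := by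
        gcongr with k
        exact h.lintegral_newtonCap_le hC hc hP D k
    _ = ∫⁻ x in unitBall d, ∑' k, w k * (reachSet φ (D.Q k)).indicator g x
          ∂intensityMeasure ν := by
        rw [lintegral_tsum fun k ↦ (hm k).aemeasurable]
        exact tsum_congr fun k ↦ (lintegral_const_mul _ (hgm.indicator (hRm k))).symm
    _ = ∫⁻ x in unitBall d, ENNReal.ofReal (ν x) *
          ∑' k, w k * (reachSet φ (D.Q k)).indicator g x := by
        unfold intensityMeasure
        rw [restrict_withDensity hball, lintegral_withDensity_eq_lintegral_mul _
          h.measurable_intensity.ennreal_ofReal (Measurable.tsum hm)]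
        rfl
    _ ≤ ∫⁻ x in unitBall d, overlapConst d (max c 0) *
          ENNReal.ofReal ((1 - ‖x‖ ^ 2) ^ 2 / ‖τ - x‖ ^ d * φ x ^ (d - 2) * ν x) := by
        refine setLIntegral_mono' hball fun x hx ↦ ?_
        have hx1 : ‖x‖ < 1 := by simpa [unitBall] using hx
        have hφ0 := h.radius_nonneg x hx
        have hν0 := h.intensity_nonneg x hx
        have hsum : ∑' k, w k * (reachSet φ (D.Q k)).indicator g x ≤
            overlapConst d (max c 0) * ENNReal.ofReal ((1 - ‖x‖) ^ 2 / ‖τ - x‖ ^ d) * g x := by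
          refine le_trans (le_of_eq ?_) (mul_le_mul_left (D.tsum_weight_le (le_max_right c 0)
            (max_lt hc zero_lt_one) hτ hx (h.radius_le_max_mul hx)) (g x))
          rw [← ENNReal.tsum_mul_right]
          refine tsum_congr fun k ↦ ?_
          have hiff : x ∈ reachSet φ (D.Q k) ↔ Metric.infDist x (D.Q k) ≤ φ x :=
            ⟨fun hxk ↦ hxk.2, fun hxk ↦ ⟨hx, hxk⟩⟩
          rw [indicator_apply, ite_mul, zero_mul, mul_ite, mul_zero]
          exact if_congr hiff rfl rfl
        calc ENNReal.ofReal (ν x) * ∑' k, w k * (reachSet φ (D.Q k)).indicator g x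
            ≤ ENNReal.ofReal (ν x) * (overlapConst d (max c 0) *
                ENNReal.ofReal ((1 - ‖x‖) ^ 2 / ‖τ - x‖ ^ d) * g x) := by gcongr
          _ = overlapConst d (max c 0) *
                ENNReal.ofReal ((1 - ‖x‖) ^ 2 / ‖τ - x‖ ^ d * φ x ^ (d - 2) * ν x) := by
              rw [ENNReal.ofReal_mul (by positivity), ENNReal.ofReal_mul (by positivity),
                ENNReal.ofReal_pow hφ0]
              ring
          _ ≤ _ := by
              have := norm_nonneg x
              gcongr
              nlinarith
    _ = _ := by
        rw [lintegral_const_mul' _ _ (overlapConst_lt_top _ _).ne]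
        rfl

theorem Admissible.poissonBalayage_le [NeZero d]
    (h : Admissible C c M r φ ν) (hd : 3 ≤ d) (hC : 1 < C)
    (hc : c < 1) (hr : r < 1) (hP : IsPoissonProcess P (unitBall d) (intensityMeasure ν) 𝓟)
    (D : WhitneyDecomposition d) (hτ : τ ∈ unitSphere d) :
    poissonBalayage φ ν τ ≤ ENNReal.ofReal (100 * d) * lowerConst d C M r *
      ∫⁻ ω, aikawaSeries D (archipelago φ (𝓟 ω)) τ ∂P := by
  rw [h.lintegral_aikawaSeries hC hc hP, ← ENNReal.tsum_mul_left]
  unfold poissonBalayage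
  rw [← D.iUnion_Q]
  refine (lintegral_iUnion_le _ _).trans (ENNReal.tsum_le_tsum fun k ↦ ?_)
  calc ∫⁻ x in D.Q k, ENNReal.ofReal ((1 - ‖x‖ ^ 2) ^ 2 / ‖τ - x‖ ^ d * φ x ^ (d - 2) * ν x)
      ≤ ∫⁻ x in D.Q k, ENNReal.ofReal (100 * d) *
          ENNReal.ofReal (D.side k ^ 2 / Metric.infDist τ (D.Q k) ^ d) *
            ENNReal.ofReal (φ x ^ (d - 2) * ν x) := by
        refine setLIntegral_mono' (D.measurableSet_Q k) fun x hx ↦ ?_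
        have hxb := D.Q_subset_unitBall k hx
        have hx1 : ‖x‖ < 1 := by simpa [unitBall] using hxb
        have hx0 := norm_nonneg x
        have hφ0 := h.radius_nonneg x hxb
        have hν0 := h.intensity_nonneg x hxb
        have hside := D.side_pos k
        have hρ := D.infDist_le hx τ
        have hρ2 := D.dist_le_two_mul_infDist hx hτ
        have hτx := one_sub_norm_le_dist hτ x
        have hρ0 : 0 < Metric.infDist τ (D.Q k) := by linarith
        rw [dist_eq_norm] at hρ
        have hsq : (1 - ‖x‖ ^ 2) ^ 2 ≤ 100 * d * D.side k ^ 2 := by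
          have h1 := D.one_sub_norm_le hx
          have h2 : 1 - ‖x‖ ^ 2 ≤ 10 * √d * D.side k := by nlinarith
          have h3 : 0 ≤ 1 - ‖x‖ ^ 2 := by nlinarith
          calc (1 - ‖x‖ ^ 2) ^ 2 ≤ (10 * √d * D.side k) ^ 2 := by gcongr
            _ = 100 * √d ^ 2 * D.side k ^ 2 := by ring
            _ = _ := by rw [Real.sq_sqrt (by positivity)]
        rw [← ENNReal.ofReal_mul (by positivity), ← ENNReal.ofReal_mul (by positivity)]
        refine ENNReal.ofReal_le_ofReal ?_
        rw [mul_assoc]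
        refine mul_le_mul_of_nonneg_right ?_ (by positivity)
        rw [← mul_div_assoc]
        gcongr
    _ = ENNReal.ofReal (100 * d) *
          ENNReal.ofReal (D.side k ^ 2 / Metric.infDist τ (D.Q k) ^ d) *
            ∫⁻ x in D.Q k, ENNReal.ofReal (φ x ^ (d - 2) * ν x) :=
        lintegral_const_mul' _ _ (ENNReal.mul_ne_top ENNReal.ofReal_ne_top ENNReal.ofReal_ne_top)
    _ ≤ ENNReal.ofReal (100 * d) *
          ENNReal.ofReal (D.side k ^ 2 / Metric.infDist τ (D.Q k) ^ d) *
            (lowerConst d C M r * ∫⁻ ω, newtonCap (archipelago φ (𝓟 ω) ∩ D.Q k) ∂P) := by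
        gcongr
        exact h.le_lintegral_newtonCap hd hC hc hr hP D k
    _ = _ := by ring

end Summation

end PercolationDiffusion

end

open PercolationDiffusion
theorem proposition1 (d : ℕ) (hd : 3 ≤ d) (C c M r : ℝ) (hC : 1 < C) (hc : c < 1) (hr : r < 1) :
    ∃ a b : ℝ, 0 < a ∧ 0 < b ∧
      ∀ φ ν : E d → ℝ, Admissible C c M r φ ν →
      ∀ (Ω : Type*) [MeasurableSpace Ω] (P : Measure Ω) [IsProbabilityMeasure P]
        (𝓟 : Ω → Set (E d)),
        IsPoissonProcess P (unitBall d)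
          (intensityMeasure ν) 𝓟 →
      ∀ D : WhitneyDecomposition d,
      ∀ τ ∈ unitSphere d,
        AEMeasurable (fun ω ↦ aikawaSeries D
          (archipelago φ (𝓟 ω)) τ) P ∧
        ENNReal.ofReal a * poissonBalayage φ ν τ ≤
          ∫⁻ ω, aikawaSeries D
            (archipelago φ (𝓟 ω)) τ ∂P ∧
        ∫⁻ ω, aikawaSeries D
            (archipelago φ (𝓟 ω)) τ ∂P ≤
          ENNReal.ofReal b * poissonBalayage φ ν τ := by
  have : NeZero d := ⟨by omega⟩
  have hL : ENNReal.ofReal (100 * d) * lowerConst d C M r ≠ ∞ :=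
    ENNReal.mul_ne_top ENNReal.ofReal_ne_top (lowerConst_lt_top hd C M r).ne
  set L := ENNReal.ofReal (100 * d) * lowerConst d C M r
  have hU : overlapConst d (max c 0) ≠ ∞ := (overlapConst_lt_top _ _).ne
  set U := overlapConst d (max c 0) with hUdef
  have hL0 : 0 ≤ L.toReal := ENNReal.toReal_nonneg
  have hU0 : 0 ≤ U.toReal := ENNReal.toReal_nonneg
  refine ⟨(L.toReal + 1)⁻¹, U.toReal + 1, by positivity, by positivity, ?_⟩
  intro φ ν h Ω _ P _ 𝓟 hP D τ hτ
  refine ⟨h.aemeasurable_aikawaSeries hC hc hP D τ, ?_, ?_⟩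
  · have hle := h.poissonBalayage_le hd hC hc hr hP D hτ
    have haL : ENNReal.ofReal (L.toReal + 1)⁻¹ * L ≤ 1 := by
      rw [← ENNReal.ofReal_toReal hL, ENNReal.toReal_ofReal hL0,
        ← ENNReal.ofReal_mul (by positivity), ENNReal.ofReal_le_one,
        inv_mul_le_one₀ (by positivity)]
      linarith
    calc _ ≤ ENNReal.ofReal (L.toReal + 1)⁻¹ *
          (L * ∫⁻ ω, aikawaSeries D (archipelago φ (𝓟 ω)) τ ∂P) := by gcongr
      _ ≤ _ := by
          rw [← mul_assoc]
          exact mul_le_of_le_one_left' haL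
  · refine (h.lintegral_aikawaSeries_le hC hc hP D hτ).trans ?_
    gcongr
    rw [← hUdef, ← ENNReal.ofReal_toReal hU, ENNReal.toReal_ofReal hU0]
    exact ENNReal.ofReal_le_ofReal (by linarith)
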